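/- **Setting.** Let $\mathcal X$ be a compact metric space (for instance a finite set or a compact subset of $\mathbb R^d$), $k$ a continuous positive semidefinite kernel on $\mathcal X$ with $k(x,x')\le 1$, and $f$ an element of the reproducing kernel Hilbert space of $k$ with $\|f\|_k\le B$. Fix $T\ge 1$, $\delta\in(0,1)$, $C\ge 0$, $\sigma\ge 0$, $\lambda\ge 1$ and $\eta>1$. In round $t=1,\dots,T$ a learner chooses $x_t\in\mathcal X$ and observes $\tilde y_t=y_t+c_t$ with $y_t=f(x_t)+\epsilon_t$. Here $\epsilon_t$ is $\sigma$-sub-Gaussian and independent of everything that precedes it (in particular of $x_t$ and of all earlier rounds), and the adversarial corruptions $c_t$ may depend on everything up to and including round $t$ and satisfy $\sum_{t\le T}|c_t|\le C$ almost surely. The regret is $R_T=\sum_{t=1}^T(\max_{x} f(x)-f(x_t))$. For points $z_1,\dots,z_n$ let $K_n=[k(z_i,z_j)]_{i,j}$, $k_n(x)=[k(z_i,x)]_i$, $\sigma_n^2(x)=k(x,x)-k_n(x)^T(K_n+\lambda I_n)^{-1}k_n(x)$ (so $\sigma_0^2(x)=k(x,x)$), and for observations $Y\in\mathbb R^n$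 let $\mu_n(x)=k_n(x)^T(K_n+\lambda I_n)^{-1}Y$. The robust mean $\tilde\mu_n$ is $\mu_n$ with each observation replaced by the average of all observations made at the same point. Let $\gamma_n=\max_{z_1,\dots,z_n}\frac12\ln\det(I_n+\lambda^{-1}K_n)$. **Algorithm RGP-PE** (parameters $\lambda,\eta,C$, $\psi>0$, $(\beta_h)_{h\ge 0}$). Start with $\mathcal X_0=\mathcal X$. In epoch $h=0,1,\dots$, with $l_h=2^{h+1}$: 1. Put $t'=0$; for $t=1,\dots,l_h$ select $z_t\in\arg\max_{x\in\mathcal X_h}\sigma_{t'}(x)$, where $\sigma_{t'}$ is computed from $z_1,\dots,z_{t'}$ (ties are resolved arbitrarily, except that the same point is selected as long as $t'$ is unchanged), and then set $t'\leftarrow t$ if $\det(I_t+\lambda^{-1}K_t)>\eta\det(I_{t'}+\lambda^{-1}K_{t'})$. 2. Let $\mathcal S_h$ be the set of selected points and $\xi_h(x)$ the fraction of the $l_h$ iterations that selected $x$. Play each $x\in\mathcal S_h$ exactly $\lceil l_h\max\{\xi_h(x),\psi\}\rceil$ times, in any order, stopping altogether after $T$ rounds in total. Let $u_h$ be the number of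 rounds played in epoch $h$ ($u_h=0$ for epochs that are not reached). 3. With $\tilde\mu^{(h)}$ and $\sigma^{(h)}$ computed from the $u_h$ rounds of epoch $h$ only and $w_h(x)=\big(\beta_h+\frac{C\sqrt{u_h}}{l_h\psi\lambda}\big)\sigma^{(h)}(x)$, set $\mathcal X_{h+1}=\{x\in\mathcal X_h:\tilde\mu^{(h)}(x)+w_h(x)\ge\max_{x'\in\mathcal X_h}(\tilde\mu^{(h)}(x')-w_h(x'))\}$. Let $\delta_h=\frac{6\delta}{(h+1)^2\pi^2}$ and, for integers $\bar u_h\ge 0$, let $$\beta_h=B+\sigma\sqrt{2\big(\gamma_{\bar u_h}+1+\ln(1/\delta_h)\big)} .$$ **Statement.** (i) Let RGP-PE be run with these $\beta_h$ and any $\psi>0$, and suppose that almost surely $u_h\le\bar u_h$ for all $h$. Then, with probability at least $1-\delta$, $|\mu^{(h)}(x)-f(x)|\le\beta_h\,\sigma^{(h)}(x)$ simultaneously for all $h\ge 0$ and $x\in\mathcal X$, where $\mu^{(h)}$ is the posterior mean from the non-corrupted observations $y_t$ of epoch $h$. If moreover $\bar u_h$ is non-decreasing in $h$, then so is $\beta_h$.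 (ii) For every $\kappa>0$ there is a constant $K$ depending only on $B,\sigma,\lambda,\eta,\kappa$ such that, whenever $\max_x k(x,x)\ge\kappa$, RGP-PE run with $\psi=\frac{\ln\eta}{2\gamma_T}$ and the above $\beta_h$ for $\bar u_h=T$ satisfies, with probability at least $1-\delta$, $$R_T\le K\,(1+\ln T)^2\Big(\sqrt{1+\ln(1/\delta)}\;\sqrt T\,\gamma_T+C\,\gamma_T^{3/2}\Big),$$ that is, $R_T=O^*(\sqrt T\,\gamma_T+C\,\gamma_T^{3/2})$, where $O^*$ hides constants and dimension-independent logarithmic factors. -/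

import Mathlib

open MeasureTheory ProbabilityTheory
open scoped NNReal ENNReal Matrix

universe u v w

noncomputable section

namespace RGPPE

section GaussianProcess

variable {X : Type u}

/-- The kernel matrix `[k(zᵢ, zⱼ)]` of a finite sequence of points. -/
def gram (k : X → X → ℝ) {n : ℕ} (z : Fin n → X) : Matrix (Fin n) (Fin n) ℝ :=
  Matrix.of fun i j => k (z i) (z j)

/-- The vector `[k(zᵢ, x)]ᵢ`. -/
def kvec (k : X → X → ℝ) {n : ℕ} (z : Fin n → X) (x : X) : Fin n → ℝ :=
  fun i => k (z i) x

/-- Posterior mean `k_n(x)ᵀ (K_n + lam I)⁻¹ Y` at `x`, given observations `y` at the points `z`. -/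
def postMean (k : X → X → ℝ) (lam : ℝ) {n : ℕ} (z : Fin n → X) (y : Fin n → ℝ) (x : X) : ℝ :=
  kvec k z x ⬝ᵥ ((gram k z + lam • (1 : Matrix (Fin n) (Fin n) ℝ))⁻¹ *ᵥ y)

/-- Posterior variance `k(x,x) - k_n(x)ᵀ (K_n + lam I)⁻¹ k_n(x)`. With no points (`n = 0`) this is
the prior variance `k(x,x)`. -/
def postVar (k : X → X → ℝ) (lam : ℝ) {n : ℕ} (z : Fin n → X) (x : X) : ℝ :=
  k x x - kvec k z x ⬝ᵥ
    ((gram k z + lam • (1 : Matrix (Fin n) (Fin n) ℝ))⁻¹ *ᵥ kvec k z x)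

/-- Posterior standard deviation. -/
def postStd (k : X → X → ℝ) (lam : ℝ) {n : ℕ} (z : Fin n → X) (x : X) : ℝ :=
  √(postVar k lam z x)

open Classical in
/-- Each observation is replaced by the average of all observations at the same point. -/
def avgObs {n : ℕ} (z : Fin n → X) (y : Fin n → ℝ) : Fin n → ℝ :=
  fun i => (∑ j, if z i = z j then y j else 0) / (∑ j, if z i = z j then (1 : ℝ) else 0)

/-- The robust posterior mean: the posterior mean formed from the averaged observations. -/
def robustMean (k : X → X → ℝ) (lam : ℝ) {n : ℕ} (z : Fin n → X) (y : Fin n → ℝ) (x : X) : ℝ :=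
  postMean k lam z (avgObs z y) x

/-- `det (I_n + lam⁻¹ K_n)`. -/
def infoDet (k : X → X → ℝ) (lam : ℝ) {n : ℕ} (z : Fin n → X) : ℝ :=
  (1 + lam⁻¹ • gram k z).det

/-- Maximum information gain `γ_n`. -/
def maxInfoGain (k : X → X → ℝ) (lam : ℝ) (n : ℕ) : ℝ :=
  ⨆ z : Fin n → X, (1 / 2) * Real.log (infoDet k lam z)

end GaussianProcess

/-- The entries `v s, …, v (s + n - 1)` of a sequence. -/
def segment {α : Type*} (v : ℕ → α) (s n : ℕ) : Fin n → α := fun i => v (s + i)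

/-- The inputs of the algorithm: kernel, regularization `lam`, switching parameter `eta`, truncation
parameter `psi`, corruption budget `C`, confidence parameters `beta h` and horizon `T`. -/
structure Params (X : Type u) where
  k : X → X → ℝ
  lam : ℝ
  eta : ℝ
  psi : ℝ
  C : ℝ
  beta : ℕ → ℝ
  T : ℕ

section Algorithm

variable {X : Type u} (P : Params X)

/-- Nominal epoch length `l_h = 2 ^ (h + 1)`: `l_0 = 2`, doubled after each epoch. -/
def nominal (h : ℕ) : ℕ := 2 ^ (h + 1)

/-- The value of `t'` at the end of iteration `t` of the selection loop of an epoch, when the loop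
selects `z 0, z 1, …` (iteration `t + 1` selects `z t`). -/
def switchTime (z : ℕ → X) : ℕ → ℕ
  | 0 => 0
  | t + 1 =>
    open Classical in
    if infoDet P.k P.lam (segment z 0 (t + 1)) >
        P.eta * infoDet P.k P.lam (segment z 0 (switchTime z t))
    then t + 1 else switchTime z t

/-- `z 0, …, z (l - 1)` is a possible outcome of the selection loop with `l` iterations and active
set `A`: each selected point maximizes `σ_{t'}` over `A`, and the selected point stays the same as
long as `t'` does (ties are otherwise resolved arbitrarily). -/
structure IsSelection (A : Set X) (l : ℕ) (z : ℕ → X) : Prop where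
  mem : ∀ t < l, z t ∈ A
  isMax : ∀ t < l, ∀ x ∈ A,
    postStd P.k P.lam (segment z 0 (switchTime P z t)) x ≤
      postStd P.k P.lam (segment z 0 (switchTime P z t)) (z t)
  consistent : ∀ t, t + 1 < l → switchTime P z (t + 1) = switchTime P z t → z (t + 1) = z t

open Classical in
/-- The set `S_h` of distinct actions selected in the loop. -/
def chosen (h : ℕ) (z : ℕ → X) : Finset X := (Finset.range (nominal h)).image z

open Classical in
/-- The empirical frequency `ξ_h(x)`. -/
def frequency (h : ℕ) (z : ℕ → X) (x : X) : ℝ :=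
  ((Finset.range (nominal h)).filter fun i => z i = x).card / (nominal h : ℝ)

/-- `u_h(x) = ⌈l_h max {ξ_h(x), ψ}⌉`. -/
def playCount (h : ℕ) (z : ℕ → X) (x : X) : ℕ :=
  ⌈(nominal h : ℝ) * max (frequency h z x) P.psi⌉₊

/-- The scheduled length `∑_{x ∈ S_h} u_h(x)` of epoch `h`. -/
def scheduledLen (h : ℕ) (z : ℕ → X) : ℕ := ∑ x ∈ chosen h z, playCount P h z x

/-- The number of rounds before epoch `h`, when the loop of epoch `j` selects `z j 0, z j 1, …`.
Rounds are numbered from `0`. -/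
def epochStart (z : ℕ → ℕ → X) : ℕ → ℕ
  | 0 => 0
  | h + 1 => epochStart z h + scheduledLen P h (z h)

/-- The number of rounds actually played in epoch `h`: the algorithm stops after `T` rounds, so
that its last epoch may be cut short (and epochs that would start later have length `0`). -/
def epochLen (z : ℕ → ℕ → X) (h : ℕ) : ℕ :=
  min (scheduledLen P h (z h)) (P.T - epochStart P z h)

/-- Half-width of the enlarged confidence interval after epoch `h`. -/
def width (z : ℕ → ℕ → X) (x : ℕ → X) (h : ℕ) (a : X) : ℝ :=
  (P.beta h + P.C * √(epochLen P z h : ℝ) / (nominal h * P.psi * P.lam)) *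
    postStd P.k P.lam (segment x (epochStart P z h) (epochLen P z h)) a

/-- The active sets: `x t` and `obs t` are the action and the (corrupted) observation of round `t`.
An action survives if its upper confidence bound is at least every active lower confidence bound. -/
def activeSet (z : ℕ → ℕ → X) (x : ℕ → X) (obs : ℕ → ℝ) : ℕ → Set X
  | 0 => Set.univ
  | h + 1 => {a | a ∈ activeSet z x obs h ∧ ∀ b ∈ activeSet z x obs h,
      robustMean P.k P.lam (segment x (epochStart P z h) (epochLen P z h))
          (segment obs (epochStart P z h) (epochLen P z h)) b - width P z x h b ≤
        robustMean P.k P.lam (segment x (epochStart P z h) (epochLen P z h))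
          (segment obs (epochStart P z h) (epochLen P z h)) a + width P z x h a}

open Classical in
/-- The number of times the action `a` is played in epoch `h`. -/
def timesPlayed (z : ℕ → ℕ → X) (x : ℕ → X) (h : ℕ) (a : X) : ℕ :=
  (Finset.univ.filter fun i => segment x (epochStart P z h) (epochLen P z h) i = a).card

/-- The selections `z`, actions `x` and observations `obs` form a possible run of the algorithm over
`T` rounds. In every epoch only selected actions are played, in any order, each `a` exactly `u_h(a)`
times (at most `u_h(a)` times if the epoch is cut short by the horizon). -/
structure IsRun (z : ℕ → ℕ → X) (x : ℕ → X) (obs : ℕ → ℝ) : Prop where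
  select : ∀ h, epochStart P z h < P.T →
    IsSelection P (activeSet P z x obs h) (nominal h) (z h)
  play_mem : ∀ h, ∀ i : Fin (epochLen P z h),
    segment x (epochStart P z h) (epochLen P z h) i ∈ chosen h (z h)
  play_le : ∀ h, ∀ a ∈ chosen h (z h), timesPlayed P z x h a ≤ playCount P h (z h) a
  play_eq : ∀ h, epochStart P z (h + 1) ≤ P.T → ∀ a ∈ chosen h (z h),
    timesPlayed P z x h a = playCount P h (z h) a

variable [MeasurableSpace X] {Ω : Type w} [mΩ : MeasurableSpace Ω]

/-- The algorithm interacting with a corrupted environment on a probability space. `ℱ t` is the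
information available before round `t`. The action of round `t` is known at that time, and so are
the selections of an epoch at its start; the noise `ε t` is `σ`-sub-Gaussian and independent of
`ℱ t`; the corruption `c t` may depend on everything up to and including round `t`. The learner
observes `f (x t) + ε t + c t`. -/
structure IsExecution (f : X → ℝ) (σ : ℝ≥0) (μ : Measure Ω) (ℱ : Filtration ℕ mΩ)
    (ε c : ℕ → Ω → ℝ) (x : ℕ → Ω → X) (z : ℕ → ℕ → Ω → X) : Prop where
  noise_meas : ∀ t < P.T, Measurable[ℱ (t + 1)] (ε t)
  noise_indep : ∀ t < P.T, Indep (MeasurableSpace.comap (ε t) inferInstance) (ℱ t) μ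
  noise_subG : ∀ t < P.T, HasSubgaussianMGF (ε t) (σ ^ 2) μ
  corr_meas : ∀ t < P.T, Measurable[ℱ (t + 1)] (c t)
  corr_budget : ∀ᵐ ω ∂μ, ∑ t ∈ Finset.range P.T, |c t ω| ≤ P.C
  action_meas : ∀ t < P.T, Measurable[ℱ t] (x t)
  selection_meas : ∀ h, ∀ i < nominal h, ∀ t < P.T, ∀ S : Set X, MeasurableSet S →
    MeasurableSet[ℱ t] {ω | epochStart P (fun j n => z j n ω) h ≤ t ∧ z h i ω ∈ S}
  run : ∀ᵐ ω ∂μ, IsRun P (fun j n => z j n ω) (fun t => x t ω)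
    (fun t => f (x t ω) + ε t ω + c t ω)

/-- On the sample `ω`, the non-corrupted confidence bounds `|μ^(h)(a) - f(a)| ≤ β_h σ^(h)(a)` hold
for all epochs `h` and all actions `a`; the posterior uses the non-corrupted observations of epoch
`h` only. -/
def ConfidenceBoundsAt (f : X → ℝ) (ε : ℕ → Ω → ℝ) (x : ℕ → Ω → X) (z : ℕ → ℕ → Ω → X)
    (ω : Ω) : Prop :=
  ∀ (h : ℕ) (a : X),
    |postMean P.k P.lam
        (segment (fun t => x t ω) (epochStart P (fun j n => z j n ω) h)
          (epochLen P (fun j n => z j n ω) h))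
        (segment (fun t => f (x t ω) + ε t ω) (epochStart P (fun j n => z j n ω) h)
          (epochLen P (fun j n => z j n ω) h)) a - f a| ≤
      P.beta h * postStd P.k P.lam
        (segment (fun t => x t ω) (epochStart P (fun j n => z j n ω) h)
          (epochLen P (fun j n => z j n ω) h)) a

end Algorithm

/-- The statement `S` holds with probability at least `1 - δ`: its failure is contained in an event
of probability at most `δ` (the measure of an arbitrary set is its outer measure). -/
def HoldsWithProb {Ω : Type w} [MeasurableSpace Ω] (μ : Measure Ω) (δ : ℝ) (S : Ω → Prop) : Prop :=
  μ {ω | ¬ S ω} ≤ ENNReal.ofReal δ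

/-- Cumulative regret `∑_{t < T} (max f - f (x t))`. -/
def regret {X : Type u} (f : X → ℝ) (T : ℕ) (x : ℕ → X) : ℝ :=
  ∑ t ∈ Finset.range T, ((⨆ a, f a) - f (x t))

/-- `δ_h = 6 δ / ((h + 1)² π²)`. -/
def deltaSeq (δ : ℝ) (h : ℕ) : ℝ := 6 * δ / (((h : ℝ) + 1) ^ 2 * Real.pi ^ 2)

/-- `β_h = B + σ √(2 (γ_{ubar h} + 1 + ln (1 / δ_h)))`. -/
def betaSeq {X : Type u} (k : X → X → ℝ) (lam B : ℝ) (σ : ℝ≥0) (δ : ℝ) (ubar : ℕ → ℕ) (h : ℕ) : ℝ :=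
  B + σ * √(2 * (maxInfoGain k lam (ubar h) + 1 + Real.log (1 / deltaSeq δ h)))

end RGPPE

end

open RGPPE

/-! Through the feature map `φ` of the RKHS everything becomes a statement about `V = lam + ∑ p_i ⊗
p_i` (`precOp`) and its inverse `W` (`covOp`), built by rank-one updates. The posterior mean at `a`
is `⟪φ a, W ∑ y_i p_i⟫`, the posterior variance is `lam ⟪φ a, W (φ a)⟫`, and the information
determinant is the product `gainProd` of the update factors (`postMean_eq`, `postVar_eq`,
`infoDet_eq`).

Confidence: the error is a bias `-lam ⟪φ a, W f⟫` plus a noise term `⟪φ a, W S⟫`, and Cauchy–Schwarz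
for `W` bounds it by `‖f‖ + √noiseForm` times the posterior deviation. The variable `exp ((noiseForm
- log gainProd) / 2)` has mean at most one: each noise is integrated out in turn against a Gaussian
mixture (`lintegral_exp_noiseForm_le`). Markov's inequality handles one epoch, whose random window
is encoded by zeroing the features outside it; a union bound over the `δ_h` handles all epochs.

Regret: write `l` for the nominal length and `γ` for the information gain. Delayed updating distorts
variances by a factor at most `eta`, so maximum-variance selection leaves variance `O(γ / l)` on the
active set (`mul_covOp_le_of_isSelection`). Each new point costs a factor `eta` of determinant, so
at most `1 + 2γ / log eta` points occur (`card_chosen_mul_log_le`), and the chosen `psi` keeps the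
epoch shorter than about `4l`. Every point is still played at least `l psi` times, which limits the
leverage of each corrupted observation (`abs_corruption_le`). The maximizer therefore survives
elimination, survivors have gap at most a few widths, and multiplying by the next epoch's length
gives order `γ √T + C γ^(3/2)` up to logarithms for each of `O(log T)` epochs.

The argument needs `psi * lam ≤ 1`. Otherwise `γ` is bounded, and since `γ ≥ log (1 + T κ / lam) /
2` so is `T`; the trivial regret bound then suffices. -/

noncomputable section
namespace RGPPE

/-! ### Rank-one updates of a regularized inverse and its quadratic form. -/

section RegularizedInverse

variable {H : Type*} [NormedAddCommGroup H] [InnerProductSpace ℝ H]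

/-- The inverse of `u ↦ lam • u + ∑_{i < n} ⟪p i, u⟫ • p i`, built by rank-one updates. -/
def covOp (lam : ℝ) (p : ℕ → H) : ℕ → H →L[ℝ] H
  | 0 => lam⁻¹ • ContinuousLinearMap.id ℝ H
  | n + 1 => covOp lam p n - (1 + inner ℝ (p n) (covOp lam p n (p n)))⁻¹ •
      InnerProductSpace.rankOne ℝ (covOp lam p n (p n)) (covOp lam p n (p n))

/-- The regularized second-moment operator `u ↦ lam • u + ∑_{i < n} ⟪p i, u⟫ • p i`. -/
def precOp (lam : ℝ) (p : ℕ → H) (n : ℕ) (u : H) : H :=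
  lam • u + ∑ i ∈ Finset.range n, inner ℝ (p i) u • p i

/-- The product of the factors `1 + ⟪p i, W_i (p i)⟫` for `i < n`, where `W_i` is `covOp`. -/
def gainProd (lam : ℝ) (p : ℕ → H) (n : ℕ) : ℝ :=
  ∏ i ∈ Finset.range n, (1 + inner ℝ (p i) (covOp lam p i (p i)))

variable {lam : ℝ} {p q : ℕ → H}

lemma covOp_symm (n : ℕ) (a b : H) :
    inner ℝ (covOp lam p n a) b = inner ℝ a (covOp lam p n b) := by
  induction n with
  | zero => simp [covOp, real_inner_smul_left, real_inner_smul_right]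
  | succ n ih =>
    simp only [covOp, sub_apply, smul_apply,
      InnerProductSpace.rankOne_apply, inner_sub_left, inner_sub_right, real_inner_smul_left,
      real_inner_smul_right, ih]
    rw [real_inner_comm (covOp lam p n (p n)) a]
    ring

lemma inner_precOp_self (n : ℕ) (a : H) :
    inner ℝ (precOp lam p n a) a =
      lam * ‖a‖ ^ 2 + ∑ i ∈ Finset.range n, inner ℝ (p i) a ^ 2 := by
  simp only [precOp, inner_add_left, real_inner_smul_left, sum_inner, real_inner_self_eq_norm_sq,
    pow_two]

lemma inner_precOp_comm (n : ℕ) (a b : H) :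
    inner ℝ (precOp lam p n a) b = inner ℝ a (precOp lam p n b) := by
  simp only [precOp, inner_add_left, inner_add_right, real_inner_smul_left, real_inner_smul_right,
    sum_inner, inner_sum]
  congr 1
  refine Finset.sum_congr rfl fun i _ => ?_
  rw [real_inner_comm a (p i)]
  ring

lemma inner_precOp_self_nonneg (hlam : 0 ≤ lam) (n : ℕ) (a : H) :
    0 ≤ inner ℝ (precOp lam p n a) a := by
  rw [inner_precOp_self]
  positivity

lemma precOp_succ (n : ℕ) (a : H) :
    precOp lam p (n + 1) a = precOp lam p n a + inner ℝ (p n) a • p n := by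
  simp only [precOp, Finset.sum_range_succ, add_assoc]

lemma precOp_sub (n : ℕ) (a b : H) :
    precOp lam p n (a - b) = precOp lam p n a - precOp lam p n b := by
  simp only [precOp, smul_sub, inner_sub_right, sub_smul, Finset.sum_sub_distrib]
  abel

lemma precOp_smul (n : ℕ) (r : ℝ) (a : H) :
    precOp lam p n (r • a) = r • precOp lam p n a := by
  simp only [precOp, smul_add, real_inner_smul_right, Finset.smul_sum, smul_smul, mul_comm]

lemma precOp_covOp (hlam : 0 < lam) (n : ℕ) (a : H) :
    precOp lam p n (covOp lam p n a) = a := by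
  induction n generalizing a with
  | zero => simp [precOp, covOp, smul_smul, hlam.ne']
  | succ n ih =>
    have hs : 0 ≤ inner ℝ (p n) (covOp lam p n (p n)) := by
      have := inner_precOp_self_nonneg (p := p) hlam.le n (covOp lam p n (p n))
      rwa [ih] at this
    have hs' : 1 + inner ℝ (p n) (covOp lam p n (p n)) ≠ 0 := by positivity
    simp only [covOp, sub_apply, smul_apply,
      InnerProductSpace.rankOne_apply, precOp_succ, precOp_sub, precOp_smul, ih, inner_sub_right,
      real_inner_smul_right, covOp_symm]
    rw [sub_add, sub_eq_self, smul_smul, ← sub_smul]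
    convert zero_smul ℝ (p n) using 2
    field_simp
    ring

lemma covOp_nonneg (hlam : 0 < lam) (n : ℕ) (a : H) : 0 ≤ inner ℝ a (covOp lam p n a) := by
  have := inner_precOp_self_nonneg (p := p) hlam.le n (covOp lam p n a)
  rwa [precOp_covOp hlam] at this

/-- A right inverse of a symmetric map that is itself symmetric is also a left inverse; no
completeness or finite dimension is needed. -/
lemma covOp_precOp (hlam : 0 < lam) (n : ℕ) (a : H) :
    covOp lam p n (precOp lam p n a) = a := by
  refine ext_inner_right ℝ fun b => ?_
  rw [covOp_symm, inner_precOp_comm, precOp_covOp hlam]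

/-- Cauchy–Schwarz for the semidefinite form of `covOp`, read off from the discriminant of a
nonnegative quadratic. -/
lemma sq_inner_covOp_le (hlam : 0 < lam) (n : ℕ) (a b : H) :
    inner ℝ a (covOp lam p n b) ^ 2 ≤
      inner ℝ a (covOp lam p n a) * inner ℝ b (covOp lam p n b) := by
  have key : ∀ t : ℝ, 0 ≤ inner ℝ b (covOp lam p n b) * (t * t) +
      2 * inner ℝ a (covOp lam p n b) * t + inner ℝ a (covOp lam p n a) := by
    intro t
    have h := covOp_nonneg (p := p) hlam n (a + t • b)
    rw [map_add, map_smul, inner_add_left, inner_add_right, inner_add_right, real_inner_smul_left,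
      real_inner_smul_left, real_inner_smul_right, real_inner_smul_right, ← covOp_symm n b a,
      real_inner_comm a] at h
    linarith
  have := discrim_le_zero key
  rw [discrim] at this
  nlinarith

lemma abs_inner_covOp_le (hlam : 0 < lam) (n : ℕ) (a b : H) :
    |inner ℝ a (covOp lam p n b)| ≤
      √(inner ℝ a (covOp lam p n a)) * √(inner ℝ b (covOp lam p n b)) := by
  rw [← Real.sqrt_mul (covOp_nonneg hlam n a)]
  exact Real.abs_le_sqrt (sq_inner_covOp_le hlam n a b)

lemma inner_covOp_succ (n : ℕ) (a b : H) :
    inner ℝ a (covOp lam p (n + 1) b) = inner ℝ a (covOp lam p n b) -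
      inner ℝ (p n) (covOp lam p n a) * inner ℝ (p n) (covOp lam p n b) /
        (1 + inner ℝ (p n) (covOp lam p n (p n))) := by
  simp only [covOp, sub_apply, smul_apply,
      InnerProductSpace.rankOne_apply, inner_sub_right, real_inner_smul_right]
  rw [covOp_symm, ← covOp_symm n (p n) a, real_inner_comm a]
  ring

lemma one_add_gain_pos (hlam : 0 < lam) (n : ℕ) :
    0 < 1 + inner ℝ (p n) (covOp lam p n (p n)) := by
  linarith [covOp_nonneg (p := p) hlam n (p n)]

lemma covOp_antitone (hlam : 0 < lam) (a : H) :
    Antitone fun n => inner ℝ a (covOp lam p n a) := by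
  refine antitone_nat_of_succ_le fun n => ?_
  rw [inner_covOp_succ]
  have : 0 ≤ inner ℝ (p n) (covOp lam p n a) * inner ℝ (p n) (covOp lam p n a) /
      (1 + inner ℝ (p n) (covOp lam p n (p n))) :=
    div_nonneg (mul_self_nonneg _) (one_add_gain_pos hlam n).le
  linarith

lemma covOp_le (hlam : 0 < lam) (n : ℕ) (a : H) :
    inner ℝ a (covOp lam p n a) ≤ lam⁻¹ * ‖a‖ ^ 2 := by
  have := covOp_antitone (p := p) hlam a (Nat.zero_le n)
  simpa [covOp, real_inner_smul_right] using this

lemma gainProd_succ (n : ℕ) : gainProd lam p (n + 1) =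
    gainProd lam p n * (1 + inner ℝ (p n) (covOp lam p n (p n))) :=
  Finset.prod_range_succ _ _

lemma gainProd_pos (hlam : 0 < lam) (n : ℕ) : 0 < gainProd lam p n :=
  Finset.prod_pos fun i _ => one_add_gain_pos hlam i

lemma gainProd_monotone (hlam : 0 < lam) : Monotone (gainProd lam p) := by
  refine monotone_nat_of_le_succ fun n => ?_
  rw [gainProd_succ]
  exact le_mul_of_one_le_right (gainProd_pos hlam n).le
    (by linarith [covOp_nonneg (p := p) hlam n (p n)])

/-- Adding data shrinks the quadratic form of `covOp` at most by the growth of `gainProd`. -/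
lemma gainProd_mul_covOp_monotone (hlam : 0 < lam) (a : H) :
    Monotone fun n => gainProd lam p n * inner ℝ a (covOp lam p n a) := by
  refine monotone_nat_of_le_succ fun n => ?_
  rw [inner_covOp_succ, gainProd_succ, mul_assoc]
  refine mul_le_mul_of_nonneg_left ?_ (gainProd_pos hlam n).le
  have hs := one_add_gain_pos (p := p) hlam n
  -- With `s` the gain, `m` the cross term and `v` the form at `a`, the claim is `v ≤ (1 + s) v -
  -- m²`, that is `m² ≤ s v`.
  have hc := sq_inner_covOp_le (p := p) hlam n (p n) a
  rw [mul_sub, mul_div_cancel₀ _ hs.ne']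
  nlinarith

/-- A larger quadratic form has a smaller inverse. -/
lemma covOp_le_covOp (hlam : 0 < lam) {n m : ℕ}
    (h : ∀ u : H, ∑ i ∈ Finset.range n, inner ℝ (p i) u ^ 2 ≤
      ∑ i ∈ Finset.range m, inner ℝ (q i) u ^ 2) (a : H) :
    inner ℝ a (covOp lam q m a) ≤ inner ℝ a (covOp lam p n a) := by
  set b := covOp lam q m a with hb
  -- Comparing the forms at `b = W_q a` gives `⟪V_p b, b⟫ ≤ ⟪a, b⟫`. Cauchy–Schwarz for `W_p` at
  -- `V_p b` and `a` gives `⟪a, b⟫² ≤ ⟪V_p b, b⟫ ⟪a, W_p a⟫`, and one factor `⟪a, b⟫` cancels.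
  have h1 : inner ℝ (precOp lam p n b) b ≤ inner ℝ a b := by
    have h2 : inner ℝ (precOp lam q m b) b = inner ℝ a b := by rw [hb, precOp_covOp hlam]
    rw [← h2, inner_precOp_self, inner_precOp_self]
    linarith [h b]
  have h2 := sq_inner_covOp_le (p := p) hlam n (precOp lam p n b) a
  rw [← covOp_symm, covOp_precOp hlam, real_inner_comm] at h2
  have h3 : 0 ≤ inner ℝ a b := covOp_nonneg hlam m a
  have h4 : 0 ≤ inner ℝ a (covOp lam p n a) := covOp_nonneg hlam n a
  rcases h3.eq_or_lt with h0 | h0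
  · rwa [← h0]
  · have : inner ℝ a b * inner ℝ a b ≤ inner ℝ a b * inner ℝ a (covOp lam p n a) := by
      nlinarith [mul_le_mul_of_nonneg_right h1 h4]
    exact le_of_mul_le_mul_left this h0

/-- Leverage bound. Testing the form at `W a` gives `s = ⟪V (W a), W a⟫ ≥ r s²` for `s = ⟪a, W a⟫`.
It is used when the data contain at least `r` copies of `a`. -/
lemma covOp_mul_le_one (hlam : 0 < lam) {n : ℕ} {a : H} {r : ℝ}
    (h : ∀ u : H, r * inner ℝ a u ^ 2 ≤ ∑ i ∈ Finset.range n, inner ℝ (p i) u ^ 2) :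
    r * inner ℝ a (covOp lam p n a) ≤ 1 := by
  set s := inner ℝ a (covOp lam p n a) with hs
  have h0 : 0 ≤ s := covOp_nonneg hlam n a
  have h1 : s = lam * ‖covOp lam p n a‖ ^ 2 +
      ∑ i ∈ Finset.range n, inner ℝ (p i) (covOp lam p n a) ^ 2 := by
    rw [← inner_precOp_self, precOp_covOp hlam]
  have h2 : r * s ^ 2 ≤ s := by
    have := h (covOp lam p n a)
    rw [← hs] at this
    have h3 : 0 ≤ lam * ‖covOp lam p n a‖ ^ 2 := by positivity
    linarith
  rcases h0.eq_or_lt with h0 | h0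
  · rw [← h0]; simp
  · have : s * (r * s) ≤ s * 1 := by nlinarith
    exact le_of_mul_le_mul_left this h0

/-- Restricting the data to the times in `[a, b)` amounts to starting at `a` and stopping at `b`. -/
lemma covOp_indicator (a b n : ℕ) :
    covOp lam (fun t => if a ≤ t ∧ t < b then p t else 0) n =
      covOp lam (fun t => p (a + t)) (min n b - a) := by
  induction n with
  | zero => simp [covOp]
  | succ n ih =>
    by_cases h : a ≤ n ∧ n < b
    · have e : min (n + 1) b - a = (n - a) + 1 := by omega
      have e' : min n b - a = n - a := by omega
      have e'' : a + (n - a) = n := by omega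
      rw [e, covOp, covOp, ih, e', if_pos h, e'']
    · have e : min (n + 1) b - a = min n b - a := by omega
      rw [e, covOp, ih, if_neg h]
      simp

lemma gainProd_indicator (a b n : ℕ) :
    gainProd lam (fun t => if a ≤ t ∧ t < b then p t else 0) n =
      gainProd lam (fun t => p (a + t)) (min n b - a) := by
  induction n with
  | zero => simp [gainProd]
  | succ n ih =>
    rw [gainProd_succ, ih, covOp_indicator]
    by_cases h : a ≤ n ∧ n < b
    · have e : min (n + 1) b - a = (n - a) + 1 := by omega
      have e' : min n b - a = n - a := by omega
      have e'' : a + (n - a) = n := by omega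
      rw [e, gainProd_succ, e', if_pos h, e'']
    · have e : min (n + 1) b - a = min n b - a := by omega
      rw [e, if_neg h]
      simp

lemma sum_indicator {E : Type*} [AddCommMonoid E] (g : ℕ → E) (a b n : ℕ) :
    ∑ t ∈ Finset.range n, (if a ≤ t ∧ t < b then g t else 0) =
      ∑ t ∈ Finset.range (min n b - a), g (a + t) := by
  induction n with
  | zero => simp
  | succ n ih =>
    rw [Finset.sum_range_succ, ih]
    by_cases h : a ≤ n ∧ n < b
    · have e : min (n + 1) b - a = (n - a) + 1 := by omega
      have e' : min n b - a = n - a := by omega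
      have e'' : a + (n - a) = n := by omega
      rw [e, Finset.sum_range_succ, e', if_pos h, e'']
    · have e : min (n + 1) b - a = min n b - a := by omega
      rw [e, if_neg h, add_zero]

end RegularizedInverse

/-! ### Posterior mean, variance and determinant in feature space. -/

section Posterior

variable {X : Type u} {H : Type*} [NormedAddCommGroup H] [InnerProductSpace ℝ H]
  {k : X → X → ℝ} {φ : X → H} {lam : ℝ}

lemma isUnit_gram_add (hφ : ∀ a b, inner ℝ (φ a) (φ b) = k a b) (hlam : 0 < lam) {n : ℕ}
    (z : Fin n → X) : IsUnit (gram k z + lam • (1 : Matrix (Fin n) (Fin n) ℝ)) := by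
  have h1 : gram k z = Matrix.gram ℝ (fun i => φ (z i)) := by
    ext i j
    simp [gram, Matrix.gram, hφ]
  have h2 : (gram k z).PosSemidef := h1 ▸ Matrix.posSemidef_gram ℝ _
  exact (Matrix.PosDef.posSemidef_add h2 (Matrix.PosDef.one.smul hlam)).isUnit

lemma mulVec_inv_gram_add (hφ : ∀ a b, inner ℝ (φ a) (φ b) = k a b) (hlam : 0 < lam) {n : ℕ}
    (z : Fin n → X) (y : Fin n → ℝ) (i : Fin n) :
    ∑ j, k (z i) (z j) * ((gram k z + lam • (1 : Matrix (Fin n) (Fin n) ℝ))⁻¹ *ᵥ y) j +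
      lam * ((gram k z + lam • (1 : Matrix (Fin n) (Fin n) ℝ))⁻¹ *ᵥ y) i = y i := by
  have hu := (Matrix.isUnit_iff_isUnit_det _).1 (isUnit_gram_add hφ hlam z)
  have h : (gram k z + lam • (1 : Matrix (Fin n) (Fin n) ℝ)) *ᵥ
      ((gram k z + lam • (1 : Matrix (Fin n) (Fin n) ℝ))⁻¹ *ᵥ y) = y := by
    rw [Matrix.mulVec_mulVec, Matrix.mul_nonsing_inv _ hu, Matrix.one_mulVec]
  have h' := congrFun h i
  rw [Matrix.add_mulVec, Matrix.smul_mulVec, Matrix.one_mulVec] at h'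
  exact h'

/-- Push-through identity: if `α` solves `(K + lam) α = y`, then `V` sends `∑ α_i φ(z_i)` to `∑ y_i
φ(z_i)`. -/
lemma postMean_eq (hφ : ∀ a b, inner ℝ (φ a) (φ b) = k a b) (hlam : 0 < lam) (v : ℕ → X)
    (s n : ℕ) (y : Fin n → ℝ) (a : X) :
    postMean k lam (segment v s n) y a =
      inner ℝ (φ a) (covOp lam (fun i => φ (v (s + i))) n (∑ i, y i • φ (v (s + i)))) := by
  set z := segment v s n with hz
  set α := (gram k z + lam • (1 : Matrix (Fin n) (Fin n) ℝ))⁻¹ *ᵥ y with hα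
  have h1 : precOp lam (fun i => φ (v (s + i))) n (∑ i, α i • φ (v (s + i))) =
      ∑ i, y i • φ (v (s + i)) := by
    rw [precOp, Finset.sum_range, Finset.smul_sum, ← Finset.sum_add_distrib]
    refine Finset.sum_congr rfl fun i _ => ?_
    have := mulVec_inv_gram_add hφ hlam z y i
    rw [← hα] at this
    rw [smul_smul, ← add_smul, ← this]
    congr 1
    rw [inner_sum, add_comm]
    congr 1
    refine Finset.sum_congr rfl fun j _ => ?_
    rw [real_inner_smul_right, hφ, mul_comm]
    rfl
  rw [← h1, covOp_precOp hlam, postMean, inner_sum, ← hα, dotProduct]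
  refine Finset.sum_congr rfl fun j _ => ?_
  rw [real_inner_smul_right, real_inner_comm, hφ, mul_comm]
  rfl

/-- The subtracted term is a posterior mean with observations `k(z_i, a)`, and `∑ k(z_i, a) φ(z_i) =
V (φ a) - lam φ a`. -/
lemma postVar_eq (hφ : ∀ a b, inner ℝ (φ a) (φ b) = k a b) (hlam : 0 < lam) (v : ℕ → X)
    (s n : ℕ) (a : X) :
    postVar k lam (segment v s n) a =
      lam * inner ℝ (φ a) (covOp lam (fun i => φ (v (s + i))) n (φ a)) := by
  have h := postMean_eq hφ hlam v s n (kvec k (segment v s n) a) a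
  have h1 : ∑ i, kvec k (segment v s n) a i • φ (v (s + i)) =
      precOp lam (fun i => φ (v (s + i))) n (φ a) - lam • φ a := by
    rw [precOp, Finset.sum_range, add_sub_cancel_left]
    refine Finset.sum_congr rfl fun i _ => ?_
    rw [hφ]
    rfl
  rw [h1, map_sub, covOp_precOp hlam, map_smul, inner_sub_right, real_inner_smul_right, hφ] at h
  rw [postVar]
  rw [postMean] at h
  linarith

lemma postStd_eq (hφ : ∀ a b, inner ℝ (φ a) (φ b) = k a b) (hlam : 0 < lam) (v : ℕ → X)
    (s n : ℕ) (a : X) :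
    postStd k lam (segment v s n) a =
      √lam * √(inner ℝ (φ a) (covOp lam (fun i => φ (v (s + i))) n (φ a))) := by
  rw [postStd, postVar_eq hφ hlam, Real.sqrt_mul hlam.le]

/-- Expanding the determinant by the Schur complement of the last point, each new point contributes
the factor `1 + lam⁻¹ * postVar`. -/
lemma infoDet_eq (hφ : ∀ a b, inner ℝ (φ a) (φ b) = k a b) (hlam : 0 < lam) (v : ℕ → X)
    (s n : ℕ) :
    infoDet k lam (segment v s n) = gainProd lam (fun i => φ (v (s + i))) n := by
  induction n with
  | zero => simp [infoDet, gainProd]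
  | succ n ih =>
    rw [gainProd_succ, ← ih]
    set A := gram k (segment v s n) with hA
    set x := v (s + n) with hx
    set b := kvec k (segment v s n) x with hb
    have hu := isUnit_gram_add hφ hlam (segment v s n)
    have hu' := (Matrix.isUnit_iff_isUnit_det _).1 hu
    have hinv : (1 + lam⁻¹ • A) * (lam • (A + lam • (1 : Matrix (Fin n) (Fin n) ℝ))⁻¹) = 1 := by
      have : (1 + lam⁻¹ • A) = lam⁻¹ • (A + lam • (1 : Matrix (Fin n) (Fin n) ℝ)) := by
        rw [smul_add, smul_smul, inv_mul_cancel₀ hlam.ne', one_smul, add_comm]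
      rw [this, Matrix.smul_mul, Matrix.mul_smul, Matrix.mul_nonsing_inv _ hu', smul_smul,
        inv_mul_cancel₀ hlam.ne', one_smul]
    let : Invertible (1 + lam⁻¹ • A) := invertibleOfRightInverse _ _ hinv
    have hblock : (1 + lam⁻¹ • gram k (segment v s (n + 1))).submatrix finSumFinEquiv finSumFinEquiv
        = Matrix.fromBlocks (1 + lam⁻¹ • A) (Matrix.of fun i (_ : Fin 1) => lam⁻¹ * b i)
          (Matrix.of fun (_ : Fin 1) i => lam⁻¹ * b i)
          (Matrix.of fun _ _ => 1 + lam⁻¹ * k x x) := by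
      have hsym : ∀ a b, k a b = k b a := fun a b => by rw [← hφ, real_inner_comm, hφ]
      ext i j
      rcases i with i | i <;> rcases j with j | j
      · simp [gram, segment, Matrix.one_apply, hA]
      · have : (Fin.castAdd 1 i) ≠ Fin.natAdd n j := by
          intro h
          have := congrArg Fin.val h
          simp at this
          omega
        simp [gram, segment, hb, kvec, hx, this]
      · have : Fin.natAdd n i ≠ (Fin.castAdd 1 j) := by
          intro h
          have := congrArg Fin.val h
          simp at this
          omega
        simp [gram, segment, hb, kvec, hx, this, hsym]
      · simp [gram, segment, hx, Subsingleton.elim i j]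
    have hvar := postVar_eq hφ hlam v s n x
    rw [infoDet, ← Matrix.det_submatrix_equiv_self finSumFinEquiv, hblock,
      Matrix.det_fromBlocks₁₁, infoDet, ← hA]
    congr 1
    have hio : ⅟(1 + lam⁻¹ • A) = lam • (A + lam • (1 : Matrix (Fin n) (Fin n) ℝ))⁻¹ :=
      invOf_eq_right_inv hinv
    rw [Matrix.det_unique, hio]
    have : inner ℝ (φ x) (covOp lam (fun i => φ (v (s + i))) n (φ x)) =
        lam⁻¹ * postVar k lam (segment v s n) x := by
      rw [hvar, ← mul_assoc, inv_mul_cancel₀ hlam.ne', one_mul]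
    rw [this, postVar, ← hb, ← hA]
    have hprod : ((Matrix.of fun (_ : Fin 1) i => lam⁻¹ * b i) *
        (lam • (A + lam • (1 : Matrix (Fin n) (Fin n) ℝ))⁻¹) *
        (Matrix.of fun i (_ : Fin 1) => lam⁻¹ * b i)) default default =
        lam⁻¹ * (b ⬝ᵥ ((A + lam • (1 : Matrix (Fin n) (Fin n) ℝ))⁻¹ *ᵥ b)) := by
      simp only [Matrix.mul_apply, Matrix.of_apply, Matrix.smul_apply, smul_eq_mul, dotProduct,
        Matrix.mulVec, Finset.mul_sum, Finset.sum_mul]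
      rw [Finset.sum_comm]
      refine Finset.sum_congr rfl fun i _ => Finset.sum_congr rfl fun j _ => ?_
      field_simp
    rw [Matrix.sub_apply, hprod, Matrix.of_apply]
    ring

end Posterior

/-! ### The maximum information gain: finiteness, monotonicity, lower bound. -/

section InformationGain

variable {X : Type u} {H : Type*} [NormedAddCommGroup H] [InnerProductSpace ℝ H]
  {k : X → X → ℝ} {φ : X → H} {lam : ℝ}

/-- A crude bound whose only role is to make the supremum in `maxInfoGain` a genuine one. -/
lemma gainProd_le_two_pow (hφ : ∀ a b, inner ℝ (φ a) (φ b) = k a b) (hk : ∀ a b, k a b ≤ 1)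
    (hlam : 1 ≤ lam) (x : ℕ → X) (n : ℕ) : gainProd lam (fun i => φ (x i)) n ≤ 2 ^ n := by
  have hl : 0 < lam := by linarith
  rw [gainProd, ← Finset.card_range n, ← Finset.prod_const, Finset.card_range]
  refine Finset.prod_le_prod (fun i _ => (one_add_gain_pos (p := fun i => φ (x i)) hl i).le)
    fun i _ => ?_
  have h := covOp_le (p := fun i => φ (x i)) hl i (φ (x i))
  rw [← real_inner_self_eq_norm_sq, hφ] at h
  have h1 : lam⁻¹ * k (x i) (x i) ≤ 1 * 1 := by
    gcongr
    · rw [← hφ]; exact real_inner_self_nonneg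
    · exact inv_le_one_of_one_le₀ hlam
    · exact hk _ _
  linarith

lemma exists_segment_eq [Nonempty X] {n : ℕ} (z : Fin n → X) :
    ∃ x : ℕ → X, segment x 0 n = z :=
  ⟨fun i => if h : i < n then z ⟨i, h⟩ else Classical.arbitrary X, by ext i; simp [segment]⟩

lemma bddAbove_infoGain [Nonempty X] (hφ : ∀ a b, inner ℝ (φ a) (φ b) = k a b)
    (hk : ∀ a b, k a b ≤ 1) (hlam : 1 ≤ lam) (n : ℕ) :
    BddAbove (Set.range fun z : Fin n → X => (1 / 2) * Real.log (infoDet k lam z)) := by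
  have hl : 0 < lam := by linarith
  refine ⟨(1 / 2) * Real.log (2 ^ n), ?_⟩
  rintro _ ⟨z, rfl⟩
  obtain ⟨x, rfl⟩ := exists_segment_eq z
  simp only
  rw [infoDet_eq hφ hl]
  gcongr
  · exact gainProd_pos hl n
  · exact gainProd_le_two_pow hφ hk hlam (fun i => x (0 + i)) n

lemma log_gainProd_le [Nonempty X] (hφ : ∀ a b, inner ℝ (φ a) (φ b) = k a b)
    (hk : ∀ a b, k a b ≤ 1) (hlam : 1 ≤ lam) (x : ℕ → X) (n : ℕ) :
    Real.log (gainProd lam (fun i => φ (x i)) n) ≤ 2 * maxInfoGain k lam n := by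
  have hl : 0 < lam := by linarith
  have h := le_ciSup (bddAbove_infoGain hφ hk hlam n) (segment x 0 n)
  rw [infoDet_eq hφ hl] at h
  simp only [zero_add] at h
  rw [maxInfoGain]
  linarith

lemma maxInfoGain_monotone [Nonempty X] (hφ : ∀ a b, inner ℝ (φ a) (φ b) = k a b)
    (hk : ∀ a b, k a b ≤ 1) (hlam : 1 ≤ lam) : Monotone (maxInfoGain k lam) := by
  have hl : 0 < lam := by linarith
  refine monotone_nat_of_le_succ fun n => ciSup_le fun z => ?_
  obtain ⟨x, rfl⟩ := exists_segment_eq z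
  have h := log_gainProd_le hφ hk hlam x (n + 1)
  have h1 := Real.log_le_log (gainProd_pos hl n)
    (gainProd_monotone (p := fun i => φ (x i)) hl n.le_succ)
  rw [infoDet_eq hφ hl]
  simp only [zero_add]
  linarith

lemma gainProd_const (hlam : 0 < lam) (a : H) (n : ℕ) :
    gainProd lam (fun _ => a) n = 1 + n * (lam⁻¹ * ‖a‖ ^ 2) := by
  -- Repeating one vector divides the form by exactly the factor by which the product grows, so
  -- `gainProd` increases arithmetically.
  have h : ∀ n, gainProd lam (fun _ => a) n * inner ℝ a (covOp lam (fun _ => a) n a) =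
      lam⁻¹ * ‖a‖ ^ 2 := by
    intro n
    induction n with
    | zero => simp [gainProd, covOp, real_inner_smul_right]
    | succ n ih =>
      have := one_add_gain_pos (p := fun _ => a) hlam n
      rw [gainProd_succ, inner_covOp_succ, ← ih]
      field_simp
      ring
  induction n with
  | zero => simp [gainProd]
  | succ n ih =>
    rw [gainProd_succ, mul_add, h, ih]
    push_cast
    ring

/-- Obtained by querying the single point `a` in all `n` rounds. It forces `T` to be bounded when
the information gain is. -/
lemma log_one_add_le_maxInfoGain (hφ : ∀ a b, inner ℝ (φ a) (φ b) = k a b)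
    (hk : ∀ a b, k a b ≤ 1) (hlam : 1 ≤ lam) {κ : ℝ} (hκ : 0 ≤ κ) {a : X} (ha : κ ≤ k a a)
    (n : ℕ) : (1 / 2) * Real.log (1 + n * (κ / lam)) ≤ maxInfoGain k lam n := by
  have hl : 0 < lam := by linarith
  have : Nonempty X := ⟨a⟩
  have h := log_gainProd_le hφ hk hlam (fun _ => a) n
  rw [gainProd_const hl, ← real_inner_self_eq_norm_sq, hφ] at h
  have h1 : Real.log (1 + n * (κ / lam)) ≤ Real.log (1 + n * (lam⁻¹ * k a a)) := by
    rw [div_eq_inv_mul]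
    gcongr
  linarith

lemma maxInfoGain_nonneg [Nonempty X] (hφ : ∀ a b, inner ℝ (φ a) (φ b) = k a b)
    (hk : ∀ a b, k a b ≤ 1) (hlam : 1 ≤ lam) (n : ℕ) : 0 ≤ maxInfoGain k lam n := by
  have h := log_one_add_le_maxInfoGain hφ hk hlam le_rfl
    (a := Classical.arbitrary X) (by rw [← hφ]; exact real_inner_self_nonneg) n
  simpa using h

end InformationGain

/-! ### Self-normalized concentration by the method of mixtures. -/

section SelfNormalized

/-- Gaussian mixture of the exponentials `exp (θ x - θ² / 2)`. -/
lemma lintegral_gaussianReal_exp (m : ℝ) (s : ℝ≥0) (x : ℝ) :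
    ∫⁻ θ, ENNReal.ofReal (Real.exp (θ * x - θ ^ 2 / 2)) ∂(gaussianReal m s) =
      ENNReal.ofReal
        (Real.exp ((s * x ^ 2 + 2 * m * x - m ^ 2) / (1 + s) / 2 - Real.log (1 + s) / 2)) := by
  rcases eq_or_ne s 0 with rfl | hs
  · rw [gaussianReal_zero_var, lintegral_dirac]
    simp
    ring_nf
  have hs0 : (0 : ℝ) < s := by positivity
  have hv : s / (1 + s) ≠ 0 := by positivity
  rw [gaussianReal_of_var_ne_zero _ hs,
    lintegral_withDensity_eq_lintegral_mul _ (measurable_gaussianPDF m s) (by fun_prop)]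
  have key : ∀ θ : ℝ, gaussianPDFReal m s θ * Real.exp (θ * x - θ ^ 2 / 2) =
      Real.exp ((s * x ^ 2 + 2 * m * x - m ^ 2) / (1 + s) / 2 - Real.log (1 + s) / 2) *
        gaussianPDFReal ((s * x + m) / (1 + s)) (s / (1 + s)) θ := by
    intro θ
    have h1 : Real.exp (-(Real.log (1 + s) / 2)) = (√(1 + (s : ℝ)))⁻¹ := by
      rw [Real.exp_neg, ← Real.log_sqrt (by positivity), Real.exp_log (by positivity)]
    have h2 : √(2 * Real.pi * s) = √(1 + (s : ℝ)) * √(2 * Real.pi * (s / (1 + s))) := by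
      rw [← Real.sqrt_mul (by positivity)]
      congr 1
      field_simp
    rw [gaussianPDFReal, gaussianPDFReal, sub_eq_add_neg (_ / 2) (Real.log _ / 2), Real.exp_add, h1]
    push_cast
    rw [h2, mul_inv, mul_assoc, ← Real.exp_add]
    have h3 : -(θ - m) ^ 2 / (2 * s) + (θ * x - θ ^ 2 / 2) =
        (s * x ^ 2 + 2 * m * x - m ^ 2) / (1 + s) / 2 +
          -(θ - (s * x + m) / (1 + s)) ^ 2 / (2 * (s / (1 + s))) := by
      field_simp
      ring
    rw [h3, Real.exp_add]
    ring
  calc _ = ∫⁻ θ, ENNReal.ofReal (Real.exp ((s * x ^ 2 + 2 * m * x - m ^ 2) / (1 + s) / 2 -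
          Real.log (1 + s) / 2)) *
        gaussianPDF ((s * x + m) / (1 + s)) (s / (1 + s)) θ := by
        refine lintegral_congr fun θ => ?_
        rw [Pi.mul_apply, gaussianPDF, gaussianPDF, ← ENNReal.ofReal_mul
          (gaussianPDFReal_nonneg _ _ _), key, ENNReal.ofReal_mul (Real.exp_pos _).le]
    _ = _ := by
        rw [lintegral_const_mul _ (measurable_gaussianPDF _ _), lintegral_gaussianPDF_eq_one _ hv,
          mul_one]

/-- The integrand is a Gaussian mixture over `θ` of `exp (θ x - θ² / 2)`; by Tonelli it suffices
that each of these integrates to at most one. -/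
lemma lintegral_exp_quadratic_le {ν : Measure ℝ} [SFinite ν]
    (hν : ∀ t : ℝ, ∫⁻ x, ENNReal.ofReal (Real.exp (t * x - t ^ 2 / 2)) ∂ν ≤ 1)
    {s : ℝ} (hs : 0 ≤ s) (m : ℝ) :
    ∫⁻ x, ENNReal.ofReal (Real.exp
      ((s * x ^ 2 + 2 * m * x - m ^ 2) / (1 + s) / 2 - Real.log (1 + s) / 2)) ∂ν ≤ 1 := by
  lift s to ℝ≥0 using hs
  simp_rw [← lintegral_gaussianReal_exp]
  rw [lintegral_lintegral_swap (by fun_prop)]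
  calc _ ≤ ∫⁻ _, 1 ∂(gaussianReal m s) := lintegral_mono fun θ => hν θ
    _ = 1 := by simp

variable {Ω : Type*} {mΩ : MeasurableSpace Ω} {μ : Measure Ω}

lemma lintegral_exp_le_one_of_subgaussian {ξ : Ω → ℝ} (h : HasSubgaussianMGF ξ 1 μ) (t : ℝ) :
    ∫⁻ ω, ENNReal.ofReal (Real.exp (t * ξ ω - t ^ 2 / 2)) ∂μ ≤ 1 := by
  have hint := h.integrable_exp_mul t
  have e : ∀ ω, Real.exp (t * ξ ω - t ^ 2 / 2) = Real.exp (-(t ^ 2 / 2)) * Real.exp (t * ξ ω) := by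
    intro ω
    rw [← Real.exp_add]
    ring_nf
  simp_rw [e]
  rw [← ofReal_integral_eq_lintegral_ofReal (hint.const_mul _)
    (Filter.Eventually.of_forall fun ω => by positivity), integral_const_mul,
    ← ENNReal.ofReal_one]
  refine ENNReal.ofReal_le_ofReal ?_
  have := h.mgf_le t
  rw [mgf] at this
  calc _ ≤ Real.exp (-(t ^ 2 / 2)) * Real.exp ((1 : ℝ≥0) * t ^ 2 / 2) := by gcongr
    _ = 1 := by rw [← Real.exp_add]; simp

variable {H : Type*} [NormedAddCommGroup H] [InnerProductSpace ℝ H]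

/-- The quadratic form `⟪S_n, W_n S_n⟫` with `S_n = ∑_{i < n} e i • p i` and `W_n = covOp lam p n`. -/
def noiseForm (lam : ℝ) (p : ℕ → H) (e : ℕ → ℝ) (n : ℕ) : ℝ :=
  inner ℝ (∑ i ∈ Finset.range n, e i • p i) (covOp lam p n (∑ i ∈ Finset.range n, e i • p i))

/-- The increment is the exponent produced by a Gaussian mixture with variance equal to the gain and
mean equal to the prediction `⟪p n, W S⟫`. -/
lemma noiseForm_succ {lam : ℝ} (hlam : 0 < lam) (p : ℕ → H) (e : ℕ → ℝ) (n : ℕ) :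
    noiseForm lam p e (n + 1) = noiseForm lam p e n +
      (inner ℝ (p n) (covOp lam p n (p n)) * e n ^ 2 +
        2 * inner ℝ (p n) (covOp lam p n (∑ i ∈ Finset.range n, e i • p i)) * e n -
        inner ℝ (p n) (covOp lam p n (∑ i ∈ Finset.range n, e i • p i)) ^ 2) /
          (1 + inner ℝ (p n) (covOp lam p n (p n))) := by
  have hs := (one_add_gain_pos (p := p) hlam n).ne'
  simp only [noiseForm, Finset.sum_range_succ]
  set S := ∑ i ∈ Finset.range n, e i • p i
  have hc : inner ℝ S (covOp lam p n (p n)) = inner ℝ (p n) (covOp lam p n S) := by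
    rw [← covOp_symm, real_inner_comm]
  simp only [inner_covOp_succ, map_add, map_smul, inner_add_left, inner_add_right,
    real_inner_smul_left, real_inner_smul_right, hc]
  field_simp
  ring

/-- Strong measurability is used because `H` is not assumed separable. -/
lemma stronglyMeasurable_covOp {m : MeasurableSpace Ω} {lam : ℝ} {p : ℕ → Ω → H} {n : ℕ}
    (hp : ∀ i < n, StronglyMeasurable[m] (p i)) :
    StronglyMeasurable[m] fun ω => covOp lam (fun i => p i ω) n := by
  induction n with
  | zero => exact stronglyMeasurable_const
  | succ n ih =>
    have hW := ih fun i hi => hp i (by omega)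
    have hpn := hp n n.lt_succ_self
    have hWp : StronglyMeasurable[m] fun ω => covOp lam (fun i => p i ω) n (p n ω) :=
      (isBoundedBilinearMap_apply (𝕜 := ℝ) (E := H) (F := H)).continuous.comp_stronglyMeasurable
        (hW.prodMk hpn)
    have hR : StronglyMeasurable[m] fun ω => InnerProductSpace.rankOne ℝ
        (covOp lam (fun i => p i ω) n (p n ω)) (covOp lam (fun i => p i ω) n (p n ω)) := by
      have hc : Continuous fun a : H => InnerProductSpace.rankOne ℝ a a := 
        (InnerProductSpace.rankOne ℝ (E := H) (F := H)).continuous.clm_apply continuous_id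
      exact hc.comp_stronglyMeasurable hWp
    have hs : StronglyMeasurable[m] fun ω =>
        (1 + inner ℝ (p n ω) (covOp lam (fun i => p i ω) n (p n ω)))⁻¹ :=
      ((stronglyMeasurable_const.add (hpn.inner hWp)).measurable.inv).stronglyMeasurable
    exact hW.sub (hs.smul hR)

lemma stronglyMeasurable_covOp_apply {m : MeasurableSpace Ω} {lam : ℝ} {p : ℕ → Ω → H} {n : ℕ}
    (hp : ∀ i < n, StronglyMeasurable[m] (p i)) {S : Ω → H} (hS : StronglyMeasurable[m] S) :
    StronglyMeasurable[m] fun ω => covOp lam (fun i => p i ω) n (S ω) :=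
  (isBoundedBilinearMap_apply (𝕜 := ℝ) (E := H) (F := H)).continuous.comp_stronglyMeasurable
    ((stronglyMeasurable_covOp hp).prodMk hS)

lemma measurable_noiseForm_sub_log {m : MeasurableSpace Ω} {lam : ℝ} {p : ℕ → Ω → H}
    {ξ : ℕ → Ω → ℝ} {n : ℕ} (hp : ∀ i < n, StronglyMeasurable[m] (p i))
    (hξ : ∀ i < n, Measurable[m] (ξ i)) :
    Measurable[m] fun ω => (noiseForm lam (fun i => p i ω) (fun i => ξ i ω) n -
      Real.log (gainProd lam (fun i => p i ω) n)) / 2 := by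
  have hS : StronglyMeasurable[m] fun ω => ∑ i ∈ Finset.range n, ξ i ω • p i ω := by
    refine Finset.stronglyMeasurable_fun_sum _ fun i hi => ?_
    have hi' := Finset.mem_range.1 hi
    exact (hξ i hi').stronglyMeasurable.smul (hp i hi')
  have h1 : Measurable[m] fun ω => noiseForm lam (fun i => p i ω) (fun i => ξ i ω) n :=
    (hS.inner (stronglyMeasurable_covOp_apply hp hS)).measurable
  have h2 : Measurable[m] fun ω => gainProd lam (fun i => p i ω) n := by
    refine Finset.measurable_fun_prod _ fun i hi => ?_
    have hi' := Finset.mem_range.1 hi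
    exact (((hp i hi').inner (stronglyMeasurable_covOp_apply
      (fun j hj => hp j (hj.trans hi')) (hp i hi'))).measurable).const_add 1
  exact (h1.sub h2.log).div_const 2

/-- The method-of-mixtures supermartingale has expectation at most one. -/
lemma lintegral_exp_noiseForm_le [IsProbabilityMeasure μ] {ℱ : Filtration ℕ mΩ} {lam : ℝ}
    (hlam : 0 < lam) {p : ℕ → Ω → H} {ξ : ℕ → Ω → ℝ} {T : ℕ}
    (hp : ∀ t < T, StronglyMeasurable[ℱ t] (p t))
    (hξ : ∀ t < T, Measurable[ℱ (t + 1)] (ξ t))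
    (hind : ∀ t < T, Indep (MeasurableSpace.comap (ξ t) inferInstance) (ℱ t) μ)
    (hsub : ∀ t < T, HasSubgaussianMGF (ξ t) 1 μ) {n : ℕ} (hn : n ≤ T) :
    ∫⁻ ω, ENNReal.ofReal (Real.exp ((noiseForm lam (fun i => p i ω) (fun i => ξ i ω) n -
      Real.log (gainProd lam (fun i => p i ω) n)) / 2)) ∂μ ≤ 1 := by
  induction n with
  | zero => simp [noiseForm, gainProd]
  | succ n ih =>
    have hnT : n < T := hn
    have hp' : ∀ i < n + 1, StronglyMeasurable[ℱ n] (p i) := fun i hi =>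
      (hp i (by omega)).mono (ℱ.mono (by omega))
    have hp'' : ∀ j ≤ n, ∀ i < j, StronglyMeasurable[ℱ n] (p i) := fun j hj i hi => hp' i (by omega)
    have hS : StronglyMeasurable[ℱ n] fun ω => ∑ i ∈ Finset.range n, ξ i ω • p i ω := by
      refine Finset.stronglyMeasurable_fun_sum _ fun i hi => ?_
      have hi' := Finset.mem_range.1 hi
      exact (((hξ i (by omega)).mono (ℱ.mono (by omega)) le_rfl).stronglyMeasurable).smul
        (hp' i (by omega))
    set s : Ω → ℝ := fun ω => inner ℝ (p n ω) (covOp lam (fun i => p i ω) n (p n ω)) with hs_def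
    set m : Ω → ℝ := fun ω => inner ℝ (p n ω) (covOp lam (fun i => p i ω) n
      (∑ i ∈ Finset.range n, ξ i ω • p i ω)) with hm_def
    set L : Ω → ℝ := fun ω => (noiseForm lam (fun i => p i ω) (fun i => ξ i ω) n -
      Real.log (gainProd lam (fun i => p i ω) n)) / 2 with hL_def
    have hs : Measurable[ℱ n] s := ((hp' n (by omega)).inner (stronglyMeasurable_covOp_apply
      (hp'' n le_rfl) (hp' n (by omega)))).measurable
    have hm : Measurable[ℱ n] m := ((hp' n (by omega)).inner (stronglyMeasurable_covOp_apply
      (hp'' n le_rfl) hS)).measurable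
    have hL : Measurable[ℱ n] L := measurable_noiseForm_sub_log (hp'' n le_rfl) fun i hi =>
      (hξ i (by omega)).mono (ℱ.mono (by omega)) le_rfl
    have hs0 : ∀ ω, 0 ≤ s ω := fun ω => covOp_nonneg hlam n _
    set Y : Ω → ℝ × ℝ × ℝ := fun ω => (L ω, max (s ω) 0, m ω) with hY_def
    have hY : Measurable[ℱ n] Y := hL.prodMk ((hs.max measurable_const).prodMk hm)
    have hYm : Measurable Y := hY.mono (ℱ.le n) le_rfl
    have hξm : Measurable (ξ n) := (hξ n hnT).mono (ℱ.le _) le_rfl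
    set F : (ℝ × ℝ × ℝ) × ℝ → ℝ≥0∞ := fun y => ENNReal.ofReal (Real.exp y.1.1) *
      ENNReal.ofReal (Real.exp ((y.1.2.1 * y.2 ^ 2 + 2 * y.1.2.2 * y.2 - y.1.2.2 ^ 2) /
        (1 + y.1.2.1) / 2 - Real.log (1 + y.1.2.1) / 2)) with hF_def
    have hF : Measurable F := by
      refine Measurable.mul (ENNReal.measurable_ofReal.comp (Real.measurable_exp.comp
        (by fun_prop))) ?_
      refine ENNReal.measurable_ofReal.comp (Real.measurable_exp.comp ?_)
      refine Measurable.sub (Measurable.div_const (Measurable.div ?_ ?_) 2)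
        (Measurable.div_const (Real.measurable_log.comp ?_) 2) <;> fun_prop
    -- The triple `Y` carries all the past that the new factor sees. By independence the joint law
    -- is a product, and Tonelli takes the place of a conditional expectation.
    have hindep : IndepFun Y (ξ n) μ := by
      rw [IndepFun_iff_Indep]
      exact (indep_of_indep_of_le_right (hind n hnT) hY.comap_le).symm
    have hmap := (indepFun_iff_map_prod_eq_prod_map_map hYm.aemeasurable hξm.aemeasurable).1 hindep
    have hpY : IsProbabilityMeasure (μ.map (ξ n)) := Measure.isProbabilityMeasure_map hξm.aemeasurable
    calc _ = ∫⁻ ω, F (Y ω, ξ n ω) ∂μ := by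
          refine lintegral_congr fun ω => ?_
          simp only [hF_def, hY_def, hL_def]
          rw [← ENNReal.ofReal_mul (Real.exp_pos _).le, ← Real.exp_add, noiseForm_succ hlam,
            gainProd_succ, Real.log_mul (gainProd_pos hlam n).ne'
              (one_add_gain_pos (p := fun i => p i ω) hlam n).ne',
            max_eq_left (hs0 ω)]
          congr 2
          simp only [hs_def, hm_def]
          ring
      _ = ∫⁻ y, F y ∂(μ.map fun ω => (Y ω, ξ n ω)) := by
          rw [lintegral_map hF (hYm.prodMk hξm)]
      _ = ∫⁻ y, ∫⁻ x, F (y, x) ∂(μ.map (ξ n)) ∂(μ.map Y) := by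
          rw [hmap, lintegral_prod _ hF.aemeasurable]
      _ = ∫⁻ ω, ∫⁻ x, F (Y ω, x) ∂(μ.map (ξ n)) ∂μ := by
          rw [lintegral_map hF.lintegral_prod_right' hYm]
      _ ≤ ∫⁻ ω, ENNReal.ofReal (Real.exp (L ω)) ∂μ := by
          refine lintegral_mono fun ω => ?_
          simp only [hF_def, hY_def]
          rw [lintegral_const_mul _ (by fun_prop)]
          refine (mul_le_mul_right ?_ _).trans (mul_one _).le
          refine lintegral_exp_quadratic_le (fun t => ?_) (le_max_right _ _) _
          rw [lintegral_map (by fun_prop) hξm]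
          exact lintegral_exp_le_one_of_subgaussian (hsub n hnT) t
      _ ≤ 1 := ih (by omega)

/-- Self-normalized tail bound. -/
lemma measure_noiseForm_le [IsProbabilityMeasure μ] {ℱ : Filtration ℕ mΩ} {lam : ℝ}
    (hlam : 0 < lam) {p : ℕ → Ω → H} {ξ : ℕ → Ω → ℝ} {T : ℕ}
    (hp : ∀ t < T, StronglyMeasurable[ℱ t] (p t))
    (hξ : ∀ t < T, Measurable[ℱ (t + 1)] (ξ t))
    (hind : ∀ t < T, Indep (MeasurableSpace.comap (ξ t) inferInstance) (ℱ t) μ)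
    (hsub : ∀ t < T, HasSubgaussianMGF (ξ t) 1 μ) {δ : ℝ} (hδ : 0 < δ) :
    μ {ω | Real.log (gainProd lam (fun i => p i ω) T) + 2 * Real.log (1 / δ) <
      noiseForm lam (fun i => p i ω) (fun i => ξ i ω) T} ≤ ENNReal.ofReal δ := by
  set g : Ω → ℝ≥0∞ := fun ω => ENNReal.ofReal (Real.exp
    ((noiseForm lam (fun i => p i ω) (fun i => ξ i ω) T -
      Real.log (gainProd lam (fun i => p i ω) T)) / 2)) with hg
  have hsubset : {ω | Real.log (gainProd lam (fun i => p i ω) T) + 2 * Real.log (1 / δ) <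
      noiseForm lam (fun i => p i ω) (fun i => ξ i ω) T} ⊆ {ω | ENNReal.ofReal (1 / δ) ≤ g ω} := by
    intro ω hω
    simp only [Set.mem_ofPred_eq] at hω ⊢
    refine ENNReal.ofReal_le_ofReal ?_
    rw [← Real.log_le_iff_le_exp (by positivity)]
    linarith
  have hgm : Measurable g := ENNReal.measurable_ofReal.comp (Real.measurable_exp.comp
    (measurable_noiseForm_sub_log (fun i hi => (hp i hi).mono (ℱ.le i))
      fun i hi => (hξ i hi).mono (ℱ.le _) le_rfl))
  have h1 := lintegral_exp_noiseForm_le hlam hp hξ hind hsub le_rfl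
  -- Markov's inequality at the fixed time `T`; no maximal inequality is needed.
  have h2 : ENNReal.ofReal (1 / δ) * μ {ω | ENNReal.ofReal (1 / δ) ≤ g ω} ≤ 1 :=
    (mul_meas_ge_le_lintegral hgm _).trans h1
  refine (measure_mono hsubset).trans ?_
  have h3 : ENNReal.ofReal δ * (ENNReal.ofReal (1 / δ) * μ {ω | ENNReal.ofReal (1 / δ) ≤ g ω}) ≤
      ENNReal.ofReal δ * 1 := by gcongr
  rwa [← mul_assoc, ← ENNReal.ofReal_mul hδ.le, mul_one_div_cancel hδ.ne', ENNReal.ofReal_one,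
    one_mul, mul_one] at h3

end SelfNormalized

/-! ### The canonical feature map and its continuity. -/

section FeatureMap

variable {X : Type u} {H : Type v} [NormedAddCommGroup H] [InnerProductSpace ℝ H] [CompleteSpace H]
  [RKHS ℝ H X ℝ]

variable (H) in
/-- The canonical feature map of a reproducing kernel Hilbert space. -/
def feature (a : X) : H := RKHS.kerFun H a (1 : ℝ)

lemma apply_eq_inner_feature (f : H) (a : X) : f a = inner ℝ (feature H a) f := by
  rw [feature, RKHS.kerFun_inner]
  simp

lemma inner_feature {k : X → X → ℝ} (hk : ∀ a b, RKHS.kernel H a b (1 : ℝ) = k a b) (a b : X) :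
    inner ℝ (feature H a) (feature H b) = k a b := by
  rw [← hk, ← RKHS.kerFun_apply, apply_eq_inner_feature]
  rfl

end FeatureMap

/-- The squared distance `‖φ b - φ a‖²` is `k b b - 2 k b a + k a a`, which is continuous in `b` and
vanishes at `a`. -/
lemma continuous_of_continuous_inner {X : Type u} [TopologicalSpace X] {H : Type v}
    [NormedAddCommGroup H] [InnerProductSpace ℝ H] {k : X → X → ℝ} {φ : X → H}
    (hφ : ∀ a b, inner ℝ (φ a) (φ b) = k a b) (hk : Continuous fun p : X × X => k p.1 p.2) :
    Continuous φ := by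
  rw [continuous_iff_continuousAt]
  intro a
  rw [ContinuousAt, tendsto_iff_norm_sub_tendsto_zero]
  have h1 : ∀ b, ‖φ b - φ a‖ = √(k b b - 2 * k b a + k a a) := by
    intro b
    rw [← hφ, ← hφ, ← hφ, real_inner_self_eq_norm_sq, real_inner_self_eq_norm_sq,
      ← norm_sub_sq_real, Real.sqrt_sq (norm_nonneg _)]
  simp_rw [h1]
  have h2 : Continuous fun b => √(k b b - 2 * k b a + k a a) := by
    have e1 : Continuous fun b => k b b := hk.comp (continuous_id.prodMk continuous_id)
    have e2 : Continuous fun b => k b a := hk.comp (continuous_id.prodMk continuous_const)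
    fun_prop
  have h3 := h2.tendsto a
  convert h3 using 2
  rw [show k a a - 2 * k a a + k a a = 0 by ring, Real.sqrt_zero]

/-! ### Confidence bounds for all epochs. -/

section Confidence

variable {X : Type u} {H : Type v} [NormedAddCommGroup H] [InnerProductSpace ℝ H]
  {φ : X → H} {f : H} {g : X → ℝ}

/-- Regression error in terms of the norm of the target and the self-normalized noise. -/
lemma abs_postMean_sub_le {k : X → X → ℝ} {lam : ℝ} (hφ : ∀ a b, inner ℝ (φ a) (φ b) = k a b)
    (hlam : 1 ≤ lam) (hg : ∀ a, g a = inner ℝ (φ a) f) (x : ℕ → X) (e : ℕ → ℝ) (s n : ℕ) (a : X) :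
    |postMean k lam (segment x s n) (segment (fun t => g (x t) + e t) s n) a - g a| ≤
      (‖f‖ + √(noiseForm lam (fun i => φ (x (s + i))) (fun i => e (s + i)) n)) *
        postStd k lam (segment x s n) a := by
  have hl : 0 < lam := by linarith
  set p : ℕ → H := fun i => φ (x (s + i)) with hp
  set S := ∑ i ∈ Finset.range n, e (s + i) • p i with hS
  set q := inner ℝ (φ a) (covOp lam p n (φ a)) with hq
  have hq0 : 0 ≤ q := covOp_nonneg hl n _
  -- The clean signal is `V f - lam f`, so applying `W` returns `f` up to the bias `-lam W f`.
  have hsum : ∑ i : Fin n, segment (fun t => g (x t) + e t) s n i • φ (x (s + i)) =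
      precOp lam p n f - lam • f + S := by
    rw [precOp, add_sub_cancel_left, hS, ← Finset.sum_add_distrib, Finset.sum_range]
    refine Finset.sum_congr rfl fun i _ => ?_
    rw [← add_smul, segment, hg]
  rw [postMean_eq hφ hl, postStd_eq hφ hl, hsum, map_add, map_sub, covOp_precOp hl, map_smul,
    inner_add_right, inner_sub_right, real_inner_smul_right, ← hg]
  have h1 : |lam * inner ℝ (φ a) (covOp lam p n f)| ≤ ‖f‖ * (√lam * √q) := by
    rw [abs_mul, abs_of_pos hl]
    have hb : √(inner ℝ f (covOp lam p n f)) ≤ (√lam)⁻¹ * ‖f‖ := by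
      refine Real.sqrt_le_iff.2 ⟨by positivity, ?_⟩
      rw [mul_pow, inv_pow, Real.sq_sqrt hl.le]
      exact covOp_le hl n f
    calc lam * |inner ℝ (φ a) (covOp lam p n f)|
        ≤ lam * (√q * ((√lam)⁻¹ * ‖f‖)) := by
          gcongr
          exact (abs_inner_covOp_le hl n _ _).trans (by gcongr)
      _ = (lam / √lam) * √q * ‖f‖ := by ring
      _ = ‖f‖ * (√lam * √q) := by rw [Real.div_sqrt]; ring
  have h2 : |inner ℝ (φ a) (covOp lam p n S)| ≤ √(noiseForm lam p (fun i => e (s + i)) n) *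
      (√lam * √q) := by
    refine (abs_inner_covOp_le hl n _ _).trans ?_
    rw [noiseForm, mul_comm]
    gcongr
    exact le_mul_of_one_le_left (Real.sqrt_nonneg _) (Real.one_le_sqrt.2 hlam)
  calc _ = |-(lam * inner ℝ (φ a) (covOp lam p n f)) + inner ℝ (φ a) (covOp lam p n S)| := by
        congr 1; ring
    _ ≤ _ := by
        refine (abs_add_le _ _).trans ?_
        rw [abs_neg, add_mul]
        exact add_le_add h1 h2

lemma epochLen_eq (P : Params X) (z : ℕ → ℕ → X) (h : ℕ) :
    epochLen P z h = min P.T (epochStart P z (h + 1)) - epochStart P z h := by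
  rw [epochLen, epochStart]
  omega

lemma noiseForm_smul (lam r : ℝ) (p : ℕ → H) (e : ℕ → ℝ) (n : ℕ) :
    noiseForm lam p (fun i => r * e i) n = r ^ 2 * noiseForm lam p e n := by
  simp only [noiseForm, mul_smul, ← Finset.smul_sum, map_smul, real_inner_smul_left,
    real_inner_smul_right]
  ring

lemma deltaSeq_pos {δ : ℝ} (hδ : 0 < δ) (h : ℕ) : 0 < deltaSeq δ h := by
  rw [deltaSeq]
  positivity

/-- Basel's sum, shifted by one index. -/
lemma hasSum_deltaSeq (δ : ℝ) : HasSum (deltaSeq δ) δ := by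
  have h1 := (hasSum_nat_add_iff' 1).2 hasSum_zeta_two
  have h2 := h1.mul_left (6 * δ / Real.pi ^ 2)
  have e1 : (fun h : ℕ => 6 * δ / Real.pi ^ 2 * (1 / ((h + 1 : ℕ) : ℝ) ^ 2)) = deltaSeq δ := by
    ext h
    rw [deltaSeq]
    push_cast
    field_simp
  have e2 : 6 * δ / Real.pi ^ 2 *
      (Real.pi ^ 2 / 6 - ∑ i ∈ Finset.range 1, 1 / (i : ℝ) ^ 2) = δ := by
    rw [Finset.sum_range_one]
    field_simp
    simp
  rwa [e1, e2] at h2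

lemma deltaSeq_antitone {δ : ℝ} (hδ : 0 < δ) : Antitone (deltaSeq δ) := by
  intro a b hab
  rw [deltaSeq, deltaSeq]
  gcongr

lemma betaSeq_monotone {k : X → X → ℝ} {lam B δ : ℝ} {σ : ℝ≥0} {ubar : ℕ → ℕ}
    [Nonempty X]
    (hφ : ∀ a b, inner ℝ (φ a) (φ b) = k a b) (hk : ∀ a b, k a b ≤ 1) (hlam : 1 ≤ lam)
    (hδ : 0 < δ) (hu : Monotone ubar) : Monotone (betaSeq k lam B σ δ ubar) := by
  intro a b hab
  rw [betaSeq, betaSeq]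
  have h1 := maxInfoGain_monotone hφ hk hlam (hu hab)
  have h2 : Real.log (1 / deltaSeq δ a) ≤ Real.log (1 / deltaSeq δ b) :=
    Real.log_le_log (one_div_pos.2 (deltaSeq_pos hδ a))
      (one_div_le_one_div_of_le (deltaSeq_pos hδ b) (deltaSeq_antitone hδ hab))
  gcongr

variable [MeasurableSpace X] {Ω : Type w} [mΩ : MeasurableSpace Ω] {μ : Measure Ω}
  {ℱ : Filtration ℕ mΩ} {ε c : ℕ → Ω → ℝ} {x : ℕ → Ω → X} {z : ℕ → ℕ → Ω → X} {P : Params X} {σ : ℝ≥0}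

/-- Only the first selection of the epoch is needed, with the whole space as target set. This makes
the epoch windows predictable. -/
lemma measurableSet_epochStart_le (hE : IsExecution P g σ μ ℱ ε c x z) (h : ℕ) {t : ℕ}
    (ht : t < P.T) : MeasurableSet[ℱ t] {ω | epochStart P (fun j n => z j n ω) h ≤ t} := by
  have := hE.selection_meas h 0 (by simp [nominal]) t ht Set.univ MeasurableSet.univ
  simpa using this

variable [MetricSpace X] [CompactSpace X] [BorelSpace X] [IsProbabilityMeasure μ]

/-- The self-normalized noise of one epoch. -/
lemma measure_epoch_noise_le (hlam : 0 < P.lam) (hφ : Continuous φ)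
    (hE : IsExecution P g σ μ ℱ ε c x z) (h : ℕ) {δ : ℝ} (hδ : 0 < δ) :
    μ {ω | ¬ noiseForm P.lam (fun i => φ (x (epochStart P (fun j n => z j n ω) h + i) ω))
        (fun i => ε (epochStart P (fun j n => z j n ω) h + i) ω)
        (epochLen P (fun j n => z j n ω) h) ≤
      σ ^ 2 * (Real.log (gainProd P.lam
        (fun i => φ (x (epochStart P (fun j n => z j n ω) h + i) ω))
          (epochLen P (fun j n => z j n ω) h)) + 2 * Real.log (1 / δ))} ≤ ENNReal.ofReal δ := by
  rcases eq_or_ne σ 0 with rfl | hσ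
  -- For `σ = 0` the noise cannot be normalized by `σ⁻¹`, but it vanishes almost surely.
  · refine le_of_eq_of_le (ae_iff.1 ?_) zero_le
    have h0 : ∀ᵐ ω ∂μ, ∀ t < P.T, ε t ω = 0 := by
      refine ae_all_iff.2 fun t => ?_
      by_cases ht : t < P.T
      · have h1 := hE.noise_subG t ht
        rw [zero_pow two_ne_zero] at h1
        filter_upwards [h1.ae_eq_zero_of_hasSubgaussianMGF_zero] with ω hω _ using hω
      · exact Filter.Eventually.of_forall fun ω h => absurd h ht
    filter_upwards [h0] with ω hω
    have : ∀ i ∈ Finset.range (epochLen P (fun j n => z j n ω) h),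
        ε (epochStart P (fun j n => z j n ω) h + i) ω •
          φ (x (epochStart P (fun j n => z j n ω) h + i) ω) = 0 := by
      intro i hi
      rw [Finset.mem_range, epochLen] at hi
      rw [hω _ (by omega), zero_smul]
    rw [noiseForm, Finset.sum_eq_zero this]
    simp
  · have hσ0 : (0 : ℝ) < σ := by positivity
    -- Whether round `t` lies in epoch `h` is known before round `t`. Zeroing the features elsewhere
    -- is therefore predictable and turns the random window into the fixed horizon `T`.
    set p : ℕ → Ω → H := fun t ω => if epochStart P (fun j n => z j n ω) h ≤ t ∧
      t < epochStart P (fun j n => z j n ω) (h + 1) then φ (x t ω) else 0 with hp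
    set ξ : ℕ → Ω → ℝ := fun t ω => (σ : ℝ)⁻¹ * ε t ω with hξ
    have hpm : ∀ t < P.T, StronglyMeasurable[ℱ t] (p t) := by
      intro t ht
      have hx : StronglyMeasurable[ℱ t] fun ω => φ (x t ω) :=
        hφ.comp_stronglyMeasurable (hE.action_meas t ht).stronglyMeasurable
      refine StronglyMeasurable.ite ?_ hx stronglyMeasurable_const
      have hA := (measurableSet_epochStart_le hE h ht).inter
        (measurableSet_epochStart_le hE (h + 1) ht).compl
      have hS : {ω | epochStart P (fun j n => z j n ω) h ≤ t} ∩
          {ω | epochStart P (fun j n => z j n ω) (h + 1) ≤ t}ᶜ =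
          {ω | epochStart P (fun j n => z j n ω) h ≤ t ∧
            t < epochStart P (fun j n => z j n ω) (h + 1)} := by
        ext ω
        simp
      rwa [hS] at hA
    have hind : ∀ t < P.T, Indep (MeasurableSpace.comap (ξ t) inferInstance) (ℱ t) μ := by
      intro t ht
      refine indep_of_indep_of_le_left (hE.noise_indep t ht) ?_
      rintro _ ⟨S, hS, rfl⟩
      exact ⟨(fun y => (σ : ℝ)⁻¹ * y) ⁻¹' S, (measurable_const_mul _) hS, rfl⟩
    have hsub : ∀ t < P.T, HasSubgaussianMGF (ξ t) 1 μ := by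
      intro t ht
      have : HasSubgaussianMGF (ξ t) (NNReal.mk ((σ : ℝ)⁻¹ ^ 2) (sq_nonneg _) * σ ^ 2) μ :=
        (hE.noise_subG t ht).const_mul (σ : ℝ)⁻¹
      have e : NNReal.mk ((σ : ℝ)⁻¹ ^ 2) (sq_nonneg _) * σ ^ 2 = 1 := by
        refine NNReal.eq ?_
        change (σ : ℝ)⁻¹ ^ 2 * (σ : ℝ) ^ 2 = 1
        field_simp
      rwa [e] at this
    refine (measure_mono fun ω hω => ?_).trans (measure_noiseForm_le hlam hpm
      (fun t ht => (hE.noise_meas t ht).const_mul _) hind hsub hδ)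
    simp only [Set.mem_ofPred_eq, not_le] at hω ⊢
    set s := epochStart P (fun j n => z j n ω) h with hs
    have e1 : gainProd P.lam (fun i => p i ω) P.T = gainProd P.lam (fun i => φ (x (s + i) ω))
        (epochLen P (fun j n => z j n ω) h) := by
      rw [epochLen_eq]
      exact gainProd_indicator (p := fun t => φ (x t ω)) _ _ _
    have e2 : noiseForm P.lam (fun i => p i ω) (fun i => ξ i ω) P.T =
        noiseForm P.lam (fun i => φ (x (s + i) ω)) (fun i => ξ (s + i) ω)
          (epochLen P (fun j n => z j n ω) h) := by
      rw [epochLen_eq, noiseForm, noiseForm]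
      have e3 := covOp_indicator (lam := P.lam) (p := fun t => φ (x t ω)) s
        (epochStart P (fun j n => z j n ω) (h + 1)) P.T
      have e4 := sum_indicator (fun t => ξ t ω • φ (x t ω)) s
        (epochStart P (fun j n => z j n ω) (h + 1)) P.T
      rw [← e3, ← e4]
      simp only [hp, smul_ite, smul_zero, hs]
    rw [e1, e2, hξ, noiseForm_smul, inv_pow, ← div_eq_inv_mul, lt_div_iff₀ (by positivity), mul_comm]
    exact hω

/-- The confidence bounds hold simultaneously for all epochs with probability at least `1 - δ`. -/
theorem holdsWithProb_confidenceBounds {k : X → X → ℝ} {lam B δ : ℝ} {ubar : ℕ → ℕ}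
    (hφ : ∀ a b, inner ℝ (φ a) (φ b) = k a b) (hk : ∀ a b, k a b ≤ 1) (hφc : Continuous φ)
    (hlam : 1 ≤ lam) (hg : ∀ a, g a = inner ℝ (φ a) f) (hf : ‖f‖ ≤ B) (hδ : 0 < δ)
    (hPk : P.k = k) (hPlam : P.lam = lam) (hPbeta : P.beta = betaSeq k lam B σ δ ubar)
    (hE : IsExecution P g σ μ ℱ ε c x z)
    (hu : ∀ᵐ ω ∂μ, ∀ h, epochLen P (fun j n => z j n ω) h ≤ ubar h) :
    HoldsWithProb μ δ (ConfidenceBoundsAt P g ε x z) := by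
  have hl : 0 < P.lam := by rw [hPlam]; linarith
  set bad : ℕ → Set Ω := fun h =>
    {ω | ¬ noiseForm P.lam (fun i => φ (x (epochStart P (fun j n => z j n ω) h + i) ω))
        (fun i => ε (epochStart P (fun j n => z j n ω) h + i) ω)
        (epochLen P (fun j n => z j n ω) h) ≤
      σ ^ 2 * (Real.log (gainProd P.lam
        (fun i => φ (x (epochStart P (fun j n => z j n ω) h + i) ω))
          (epochLen P (fun j n => z j n ω) h)) + 2 * Real.log (1 / deltaSeq δ h))} with hbad
  have hsubset : {ω | ¬ ConfidenceBoundsAt P g ε x z ω} ⊆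
      (⋃ h, bad h) ∪ {ω | ¬ ∀ h, epochLen P (fun j n => z j n ω) h ≤ ubar h} := by
    intro ω hω
    by_contra hc
    simp only [Set.mem_union, Set.mem_iUnion, not_or, not_exists, hbad, Set.mem_ofPred_eq,
      not_not] at hc
    refine hω fun h a => ?_
    have hX : Nonempty X := ⟨a⟩
    rw [hPk, hPbeta]
    have h1 := hc.1 h
    have h2 := hc.2 h
    rw [hPlam] at h1 ⊢
    refine (abs_postMean_sub_le hφ hlam hg (fun t => x t ω) (fun t => ε t ω) _ _ a).trans ?_
    refine mul_le_mul_of_nonneg_right ?_ (Real.sqrt_nonneg _)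
    rw [betaSeq]
    refine add_le_add hf ?_
    refine (Real.sqrt_le_sqrt h1).trans ?_
    rw [Real.sqrt_mul (by positivity), Real.sqrt_sq (by positivity)]
    -- The log determinant is at most `2γ`, so the noise bound is `σ² (2γ + 2 log (1 / δ_h))`; the
    -- summand `1` in `betaSeq` is slack.
    have h3 := log_gainProd_le hφ hk hlam
      (fun i => x (epochStart P (fun j n => z j n ω) h + i) ω) (epochLen P (fun j n => z j n ω) h)
    have h4 := maxInfoGain_monotone hφ hk hlam h2
    gcongr
    linarith
  rw [HoldsWithProb]
  calc _ ≤ μ (⋃ h, bad h) + μ {ω | ¬ ∀ h, epochLen P (fun j n => z j n ω) h ≤ ubar h} :=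
        (measure_mono hsubset).trans (measure_union_le _ _)
    _ = μ (⋃ h, bad h) := by rw [ae_iff.1 hu, add_zero]
    _ ≤ ∑' h, μ (bad h) := measure_iUnion_le _
    _ ≤ ∑' h, ENNReal.ofReal (deltaSeq δ h) :=
        ENNReal.tsum_le_tsum fun h => measure_epoch_noise_le hl hφc hE h (deltaSeq_pos hδ h)
    _ = ENNReal.ofReal δ := by
        rw [← ENNReal.ofReal_tsum_of_nonneg (fun h => (deltaSeq_pos hδ h).le)
          (hasSum_deltaSeq δ).summable, (hasSum_deltaSeq δ).tsum_eq]

end Confidence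

/-! ### The selection loop: rare switching, small variance, epoch lengths. -/

section Selection

variable {X : Type u} {H : Type v} [NormedAddCommGroup H] [InnerProductSpace ℝ H]
  {φ : X → H} {P : Params X}

lemma switchTime_le (z : ℕ → X) (t : ℕ) : switchTime P z t ≤ t := by
  induction t with
  | zero => simp [switchTime]
  | succ t ih =>
    rw [switchTime]
    split_ifs <;> omega

/-- The invariant of the delayed update: failing the switching test is exactly this inequality. -/
lemma gainProd_le_mul_switchTime (hφ : ∀ a b, inner ℝ (φ a) (φ b) = P.k a b) (hlam : 0 < P.lam)
    (heta : 1 ≤ P.eta) (z : ℕ → X) (t : ℕ) :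
    gainProd P.lam (fun i => φ (z i)) t ≤
      P.eta * gainProd P.lam (fun i => φ (z i)) (switchTime P z t) := by
  have key : ∀ n, gainProd P.lam (fun i => φ (z i)) n ≤
      P.eta * gainProd P.lam (fun i => φ (z i)) n := fun n =>
    le_mul_of_one_le_left (gainProd_pos hlam n).le heta
  cases t with
  | zero => exact key 0
  | succ t =>
    rw [switchTime]
    split_ifs with h
    · exact key _
    · rw [infoDet_eq hφ hlam, infoDet_eq hφ hlam, gt_iff_lt, not_lt] at h
      simpa only [zero_add] using h

open Classical in
-- A new point can appear only after a switch, by `IsSelection.consistent`, and each switch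
-- multiplies the determinant by more than `eta`. The first point is free, hence the exponent `card
-- - 1`.
lemma eta_pow_card_image_le (hφ : ∀ a b, inner ℝ (φ a) (φ b) = P.k a b) (hlam : 0 < P.lam)
    (heta : 1 ≤ P.eta) {A : Set X} {l : ℕ} {z : ℕ → X} (hz : IsSelection P A l z) {t : ℕ}
    (ht : t < l) :
    P.eta ^ (((Finset.range (t + 1)).image z).card - 1) ≤
      gainProd P.lam (fun i => φ (z i)) (switchTime P z t) := by
  induction t with
  | zero => simp [switchTime, gainProd]
  | succ t ih =>
    have ih' := ih (by omega)
    rw [Finset.range_add_one, Finset.image_insert]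
    by_cases hsw : infoDet P.k P.lam (segment z 0 (t + 1)) >
        P.eta * infoDet P.k P.lam (segment z 0 (switchTime P z t))
    · have e : switchTime P z (t + 1) = t + 1 := by rw [switchTime, if_pos hsw]
      rw [infoDet_eq hφ hlam, infoDet_eq hφ hlam] at hsw
      simp only [zero_add] at hsw
      rw [e]
      have hcard := Finset.card_insert_le (z (t + 1)) ((Finset.range (t + 1)).image z)
      have hpos : 0 < ((Finset.range (t + 1)).image z).card :=
        Finset.card_pos.2 ((Finset.nonempty_range_iff.2 (by omega)).image z)
      calc _ ≤ P.eta ^ ((((Finset.range (t + 1)).image z).card - 1) + 1) :=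
            pow_le_pow_right₀ heta (by omega)
        _ = P.eta * P.eta ^ (((Finset.range (t + 1)).image z).card - 1) := by rw [pow_succ']
        _ ≤ P.eta * gainProd P.lam (fun i => φ (z i)) (switchTime P z t) := by gcongr
        _ ≤ _ := hsw.le
    · have e : switchTime P z (t + 1) = switchTime P z t := by rw [switchTime, if_neg hsw]
      have hzt := hz.consistent t ht e
      rw [e, Finset.insert_eq_of_mem]
      · exact ih'
      · rw [hzt]
        exact Finset.mem_image_of_mem z (Finset.mem_range.2 t.lt_succ_self)

lemma nominal_pos (h : ℕ) : 0 < nominal h := by simp [nominal]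

/-- The last selection uses a switch time of at most `nominal h - 1`, so `n` may be one less than
the nominal length. This matters in a final epoch, where the nominal length can be `T + 1`. -/
lemma card_chosen_mul_log_le [Nonempty X] (hφ : ∀ a b, inner ℝ (φ a) (φ b) = P.k a b)
    (hk : ∀ a b, P.k a b ≤ 1) (hlam : 1 ≤ P.lam) (heta : 1 < P.eta) {A : Set X} {h : ℕ}
    {z : ℕ → X} (hz : IsSelection P A (nominal h) z) {n : ℕ} (hn : nominal h ≤ n + 1) :
    ((chosen h z).card : ℝ) * Real.log P.eta ≤ Real.log P.eta + 2 * maxInfoGain P.k P.lam n := by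
  classical
  have hl : 0 < P.lam := by linarith
  have hpos := nominal_pos h
  have h1 := eta_pow_card_image_le hφ hl heta.le hz (t := nominal h - 1) (by omega)
  rw [Nat.sub_add_cancel hpos] at h1
  have h2 := gainProd_monotone (p := fun i => φ (z i)) hl
    ((switchTime_le (P := P) z (nominal h - 1)).trans (by omega : nominal h - 1 ≤ n))
  have h3 := Real.log_le_log (by positivity) (h1.trans h2)
  have h4 := log_gainProd_le hφ hk hlam z n
  rw [Real.log_pow] at h3
  have hc : 0 < (chosen h z).card :=
    Finset.card_pos.2 ((Finset.nonempty_range_iff.2 hpos.ne').image z)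
  have h5 : (((chosen h z).card - 1 : ℕ) : ℝ) = (chosen h z).card - 1 := by
    rw [Nat.cast_sub hc, Nat.cast_one]
  have h6 : (((chosen h z).card : ℝ) - 1) * Real.log P.eta ≤
      Real.log (gainProd P.lam (fun i => φ (z i)) n) := by
    rw [← h5]
    exact h3
  linarith

lemma le_two_mul_log_one_add {s : ℝ} (h0 : 0 ≤ s) (h1 : s ≤ 1) : s ≤ 2 * Real.log (1 + s) := by
  have h := Real.one_sub_inv_le_log_of_pos (by linarith : 0 < 1 + s)
  have : s / 2 ≤ 1 - (1 + s)⁻¹ := by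
    rw [← sub_nonneg]
    have : 1 - (1 + s)⁻¹ - s / 2 = s * (1 - s) / (2 * (1 + s)) := by field_simp; ring
    rw [this]
    exact div_nonneg (mul_nonneg h0 (by linarith)) (by linarith)
  linarith

/-- Maximum-variance selection makes the posterior variance uniformly small. -/
lemma mul_covOp_le_of_isSelection [Nonempty X] (hφ : ∀ a b, inner ℝ (φ a) (φ b) = P.k a b)
    (hk : ∀ a b, P.k a b ≤ 1) (hlam : 1 ≤ P.lam) (heta : 1 < P.eta) {A : Set X} {l : ℕ}
    {z : ℕ → X} (hz : IsSelection P A l z) {a : X} (ha : a ∈ A) :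
    l * inner ℝ (φ a) (covOp P.lam (fun i => φ (z i)) l (φ a)) ≤
      4 * P.eta * maxInfoGain P.k P.lam l := by
  have hl : 0 < P.lam := by linarith
  set p : ℕ → H := fun i => φ (z i) with hp
  have key : ∀ t ∈ Finset.range l, inner ℝ (φ a) (covOp P.lam p l (φ a)) ≤
      P.eta * (2 * Real.log (1 + inner ℝ (p t) (covOp P.lam p t (p t)))) := by
    intro t ht
    rw [Finset.mem_range] at ht
    set t' := switchTime P z t with ht'
    have hle : t' ≤ t := switchTime_le z t
    have h1 : inner ℝ (φ a) (covOp P.lam p l (φ a)) ≤ inner ℝ (φ a) (covOp P.lam p t' (φ a)) :=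
      covOp_antitone hl (φ a) (hle.trans ht.le)
    have h2 : inner ℝ (φ a) (covOp P.lam p t' (φ a)) ≤ inner ℝ (p t) (covOp P.lam p t' (p t)) := by
      have := hz.isMax t ht a ha
      rw [postStd_eq hφ hl, postStd_eq hφ hl] at this
      simp only [zero_add] at this
      have h3 := le_of_mul_le_mul_left this (Real.sqrt_pos.2 hl)
      exact (Real.sqrt_le_sqrt_iff (covOp_nonneg hl _ _)).1 h3
    -- The variance at the stale time `t'` exceeds the current one by at most the determinant ratio,
    -- which the switching rule keeps below `eta`.
    have h3 : inner ℝ (p t) (covOp P.lam p t' (p t)) ≤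
        P.eta * inner ℝ (p t) (covOp P.lam p t (p t)) := by
      have h4 := gainProd_mul_covOp_monotone (p := p) hl (p t) hle
      simp only at h4
      have h5 := gainProd_le_mul_switchTime hφ hl heta.le z t
      have h6 := mul_le_mul_of_nonneg_right h5 (covOp_nonneg (p := p) hl t (p t))
      have h7 := gainProd_pos (p := p) hl t'
      refine le_of_mul_le_mul_left ?_ h7
      calc _ ≤ _ := h4
        _ ≤ _ := h6
        _ = _ := by ring
    have h4 : inner ℝ (p t) (covOp P.lam p t (p t)) ≤ 1 := by
      refine (covOp_le hl t _).trans ?_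
      rw [← real_inner_self_eq_norm_sq, hp, hφ]
      exact mul_le_one₀ (inv_le_one_of_one_le₀ hlam)
        (by rw [← hφ]; exact real_inner_self_nonneg) (hk _ _)
    have h5 := le_two_mul_log_one_add (covOp_nonneg (p := p) hl t (p t)) h4
    have heta0 : 0 ≤ P.eta := by linarith
    calc _ ≤ P.eta * inner ℝ (p t) (covOp P.lam p t (p t)) := h1.trans (h2.trans h3)
      _ ≤ _ := by gcongr
  -- Summing over the loop, the logarithms combine into `log gainProd ≤ 2γ`; the final `4` is this
  -- `2` times the `2` from `s ≤ 2 log (1 + s)`.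
  have hsum := Finset.sum_le_sum key
  rw [Finset.sum_const, Finset.card_range, nsmul_eq_mul, ← Finset.mul_sum, ← Finset.mul_sum,
    ← Real.log_prod fun i _ => (one_add_gain_pos (p := p) hl i).ne'] at hsum
  have hlog : Real.log (∏ i ∈ Finset.range l, (1 + inner ℝ (p i) (covOp P.lam p i (p i)))) ≤
      2 * maxInfoGain P.k P.lam l := log_gainProd_le hφ hk hlam z l
  calc _ ≤ _ := hsum
    _ ≤ P.eta * (2 * (2 * maxInfoGain P.k P.lam l)) := by gcongr
    _ = _ := by ring

open Classical in
lemma sum_card_fiber_chosen (h : ℕ) (z : ℕ → X) :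
    ∑ a ∈ chosen h z, ((Finset.range (nominal h)).filter fun i => z i = a).card = nominal h := by
  rw [chosen, ← Finset.card_eq_sum_card_image, Finset.card_range]

open Classical in
lemma nominal_mul_frequency (h : ℕ) (z : ℕ → X) (a : X) :
    (nominal h : ℝ) * frequency h z a =
      ((Finset.range (nominal h)).filter fun i => z i = a).card := by
  have : (nominal h : ℝ) ≠ 0 := by exact_mod_cast (nominal_pos h).ne'
  rw [frequency, mul_div_cancel₀ _ this]

open Classical in
lemma card_fiber_le_playCount (h : ℕ) (z : ℕ → X) (a : X) :
    ((Finset.range (nominal h)).filter fun i => z i = a).card ≤ playCount P h z a := by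
  rw [playCount, ← Nat.cast_le (α := ℝ), ← nominal_mul_frequency]
  exact le_trans (by gcongr; exact le_max_left _ _) (Nat.le_ceil _)

lemma nominal_mul_psi_le_playCount (h : ℕ) (z : ℕ → X) (a : X) :
    (nominal h : ℝ) * P.psi ≤ playCount P h z a :=
  le_trans (by gcongr; exact le_max_right _ _) (Nat.le_ceil _)

lemma nominal_le_scheduledLen (h : ℕ) (z : ℕ → X) : nominal h ≤ scheduledLen P h z := by
  classical
  rw [scheduledLen, ← sum_card_fiber_chosen h z]
  exact Finset.sum_le_sum fun a _ => card_fiber_le_playCount h z a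

/-- Bound the maximum by the sum and the ceiling by adding one: the frequencies contribute one
nominal length, and the roundings at most another because at most `nominal h` points are chosen. -/
lemma scheduledLen_le (hpsi : 0 ≤ P.psi) (h : ℕ) (z : ℕ → X) :
    (scheduledLen P h z : ℝ) ≤ nominal h * (2 + P.psi * (chosen h z).card) := by
  classical
  have hcard : ((chosen h z).card : ℝ) ≤ nominal h := by
    have := Finset.card_image_le (s := Finset.range (nominal h)) (f := z)
    rw [Finset.card_range] at this
    exact_mod_cast this
  have h1 : ∀ a ∈ chosen h z, (playCount P h z a : ℝ) ≤
      ((Finset.range (nominal h)).filter fun i => z i = a).card + (nominal h * P.psi + 1) := by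
    intro a _
    have hf : 0 ≤ frequency h z a := by rw [frequency]; positivity
    rw [playCount, ← nominal_mul_frequency]
    refine (Nat.ceil_lt_add_one (by positivity)).le.trans ?_
    have : max (frequency h z a) P.psi ≤ frequency h z a + P.psi :=
      max_le (by linarith) (by linarith)
    have := mul_le_mul_of_nonneg_left this (Nat.cast_nonneg (α := ℝ) (nominal h))
    linarith
  have h2 := Finset.sum_le_sum h1
  rw [Finset.sum_add_distrib, ← Nat.cast_sum (chosen h z) fun a =>
    ((Finset.range (nominal h)).filter fun i => z i = a).card, sum_card_fiber_chosen,
    Finset.sum_const, nsmul_eq_mul] at h2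
  rw [scheduledLen, Nat.cast_sum]
  linarith

/-- The geometric sum `2 + 4 + ⋯ + 2 ^ h = 2 ^ (h + 1) - 2` of nominal lengths. -/
lemma two_pow_le_epochStart (z : ℕ → ℕ → X) (h : ℕ) : 2 ^ (h + 1) ≤ epochStart P z h + 2 := by
  induction h with
  | zero => simp [epochStart]
  | succ h ih =>
    have := nominal_le_scheduledLen (P := P) h (z h)
    rw [nominal] at this
    rw [epochStart, pow_succ]
    omega

lemma epochStart_mono (z : ℕ → ℕ → X) : Monotone (epochStart P z) :=
  monotone_nat_of_le_succ fun h => by rw [epochStart]; omega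

end Selection

/-! ### Played data versus selected data, and the effect of corruption. -/

section Run

variable {X : Type u} {H : Type v} [NormedAddCommGroup H] [InnerProductSpace ℝ H]
  {φ : X → H} {P : Params X} {z : ℕ → ℕ → X} {x : ℕ → X} {obs : ℕ → ℝ}

lemma epochLen_of_complete {h : ℕ} (hT : epochStart P z (h + 1) ≤ P.T) :
    epochLen P z h = scheduledLen P h (z h) := by
  rw [epochStart] at hT
  rw [epochLen]
  omega

lemma sum_epoch_eq (hrun : IsRun P z x obs) (h : ℕ) (F : X → ℝ) :
    ∑ i ∈ Finset.range (epochLen P z h), F (x (epochStart P z h + i)) =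
      ∑ a ∈ chosen h (z h), timesPlayed P z x h a * F a := by
  classical
  rw [Finset.sum_range, ← Finset.sum_fiberwise_of_maps_to (t := chosen h (z h))
    (g := segment x (epochStart P z h) (epochLen P z h)) (fun i _ => hrun.play_mem h i)]
  refine Finset.sum_congr rfl fun a _ => ?_
  rw [timesPlayed, ← nsmul_eq_mul, ← Finset.sum_const]
  refine Finset.sum_congr (by congr) fun i hi => ?_
  rw [← (Finset.mem_filter.1 hi).2]
  rfl

/-- In a completed epoch each point is played at least as often as it was selected, so variance
bounds pass from the selection loop to the data. -/
lemma sum_selection_le (hrun : IsRun P z x obs) {h : ℕ} (hT : epochStart P z (h + 1) ≤ P.T)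
    {F : X → ℝ} (hF : ∀ a, 0 ≤ F a) :
    ∑ i ∈ Finset.range (nominal h), F (z h i) ≤
      ∑ i ∈ Finset.range (epochLen P z h), F (x (epochStart P z h + i)) := by
  classical
  rw [sum_epoch_eq hrun, Finset.sum_comp F (z h)]
  change ∑ a ∈ chosen h (z h), _ ≤ _
  refine Finset.sum_le_sum fun a ha => ?_
  rw [nsmul_eq_mul, hrun.play_eq h hT a ha]
  refine mul_le_mul_of_nonneg_right ?_ (hF a)
  exact_mod_cast card_fiber_le_playCount h (z h) a

/-- This is what the truncation at `psi` buys: every chosen point occurs at least `nominal h * psi`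
times. -/
lemma mul_le_sum_epoch (hrun : IsRun P z x obs) {h : ℕ} (hT : epochStart P z (h + 1) ≤ P.T)
    {F : X → ℝ} (hF : ∀ a, 0 ≤ F a) {a : X} (ha : a ∈ chosen h (z h)) :
    nominal h * P.psi * F a ≤
      ∑ i ∈ Finset.range (epochLen P z h), F (x (epochStart P z h + i)) := by
  rw [sum_epoch_eq hrun]
  refine le_trans ?_ (Finset.single_le_sum (f := fun a => timesPlayed P z x h a * F a)
    (fun b _ => mul_nonneg (Nat.cast_nonneg _) (hF b)) ha)
  rw [hrun.play_eq h hT a ha]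
  exact mul_le_mul_of_nonneg_right (nominal_mul_psi_le_playCount h (z h) a) (hF a)

/-- Averaging the observations made at equal points does not change the posterior mean. -/
lemma robustMean_eq_postMean {k : X → X → ℝ} {lam : ℝ} (hφ : ∀ a b, inner ℝ (φ a) (φ b) = k a b)
    (hlam : 0 < lam) (x : ℕ → X) (s n : ℕ) (y : Fin n → ℝ) (a : X) :
    robustMean k lam (segment x s n) y a = postMean k lam (segment x s n) y a := by
  classical
  rw [robustMean, postMean_eq hφ hlam, postMean_eq hφ hlam]
  -- The posterior mean depends on the observations only through `∑ y_i φ(z_i)`, which averaging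
  -- within equal points preserves.
  congr 2
  set q : Fin n → X := segment x s n with hq
  change ∑ i, avgObs q y i • φ (q i) = ∑ i, y i • φ (q i)
  set N : Fin n → ℝ := fun i => ∑ j, if q i = q j then (1 : ℝ) else 0 with hN
  have hN0 : ∀ i, N i ≠ 0 := by
    intro i
    have : (1 : ℝ) ≤ N i := by
      have := Finset.single_le_sum (f := fun j => if q i = q j then (1 : ℝ) else 0)
        (fun j _ => by split_ifs <;> norm_num) (Finset.mem_univ i)
      rwa [if_pos rfl] at this
    linarith
  calc ∑ i, avgObs q y i • φ (q i)
      = ∑ i, ∑ j, (if q i = q j then y j / N j else 0) • φ (q j) := by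
        refine Finset.sum_congr rfl fun i _ => ?_
        have : avgObs q y i = ∑ j, if q i = q j then y j / N j else 0 := by
          rw [avgObs, Finset.sum_div]
          refine Finset.sum_congr (by congr) fun j _ => ?_
          split_ifs with h
          · congr 1
            simp only [hN, h]
          · simp
        rw [this, Finset.sum_smul]
        refine Finset.sum_congr rfl fun j _ => ?_
        split_ifs with h
        · rw [h]
        · simp
    _ = ∑ j, ∑ i, (if q i = q j then y j / N j else 0) • φ (q j) := Finset.sum_comm
    _ = ∑ j, y j • φ (q j) := by
        refine Finset.sum_congr rfl fun j _ => ?_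
        rw [← Finset.sum_smul]
        congr 1
        have : ∀ i, (if q i = q j then y j / N j else 0) =
            y j / N j * (if q j = q i then (1 : ℝ) else 0) := by
          intro i
          simp only [eq_comm (a := q i), mul_ite, mul_one, mul_zero]
        simp_rw [this]
        rw [← Finset.mul_sum]
        exact div_mul_cancel₀ _ (hN0 j)

/-- By Cauchy–Schwarz, the corruption of one round has influence at most its size times the form at
`a` and the form at the played point, both under square roots. The latter form is at most `1 /
(nominal h * psi)` by the leverage bound. -/
lemma abs_corruption_le {C : ℝ} (hφ : ∀ a b, inner ℝ (φ a) (φ b) = P.k a b) (hlam : 0 < P.lam)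
    (hpsi : 0 < P.psi) (hpl : P.psi * P.lam ≤ 1) (hrun : IsRun P z x obs) {h : ℕ}
    (hT : epochStart P z (h + 1) ≤ P.T) {c : ℕ → ℝ}
    (hc : ∑ t ∈ Finset.range P.T, |c t| ≤ C) (a : X) :
    |inner ℝ (φ a) (covOp P.lam (fun i => φ (x (epochStart P z h + i))) (epochLen P z h)
      (∑ i ∈ Finset.range (epochLen P z h),
        c (epochStart P z h + i) • φ (x (epochStart P z h + i))))| ≤
      C * √(epochLen P z h : ℝ) / (nominal h * P.psi * P.lam) *
        postStd P.k P.lam (segment x (epochStart P z h) (epochLen P z h)) a := by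
  set s := epochStart P z h with hs
  set n := epochLen P z h with hn
  set W := covOp P.lam (fun i => φ (x (s + i))) n with hW
  set r : ℝ := nominal h * P.psi with hr
  have hnom : (0 : ℝ) < nominal h := by exact_mod_cast nominal_pos h
  have hr0 : 0 < r := by positivity
  have hterm : ∀ i ∈ Finset.range n, |c (s + i) * inner ℝ (φ a) (W (φ (x (s + i))))| ≤
      |c (s + i)| * (√(inner ℝ (φ a) (W (φ a))) * √(1 / r)) := by
    intro i hi
    rw [abs_mul]
    gcongr
    refine (abs_inner_covOp_le hlam n _ _).trans ?_
    gcongr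
    rw [le_div_iff₀ hr0, mul_comm]
    refine covOp_mul_le_one hlam fun u => ?_
    exact mul_le_sum_epoch hrun hT (F := fun b => inner ℝ (φ b) u ^ 2) (fun b => sq_nonneg _)
      (hrun.play_mem h ⟨i, Finset.mem_range.1 hi⟩)
  have hsum : ∑ i ∈ Finset.range n, |c (s + i)| ≤ C := by
    refine le_trans ?_ hc
    have e : n = min P.T (epochStart P z (h + 1)) - s := epochLen_eq P z h
    rw [e, ← sum_indicator (fun t => |c t|)]
    refine Finset.sum_le_sum fun t _ => ?_
    split_ifs
    · exact le_rfl
    · exact abs_nonneg _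
  have hC : 0 ≤ C := (Finset.sum_nonneg fun i _ => abs_nonneg _).trans hsum
  have hrn : r * P.lam ≤ n := by
    have h1 : (nominal h : ℝ) ≤ n := by
      rw [hn, epochLen_of_complete hT]
      exact_mod_cast nominal_le_scheduledLen h (z h)
    calc r * P.lam = nominal h * (P.psi * P.lam) := by rw [hr]; ring
      _ ≤ nominal h * 1 := by gcongr
      _ ≤ n := by linarith
  -- This converts the natural leverage factor into the one in the algorithm's width; it needs `r *
  -- lam ≤ n`, which is where `psi * lam ≤ 1` enters.
  have hroot : √(1 / r) ≤ √(n : ℝ) / (r * P.lam) * √P.lam := by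
    have h1 : √(r * P.lam) ≤ √(n : ℝ) := Real.sqrt_le_sqrt hrn
    have h2 : √(1 / r) = √(r * P.lam) / (r * P.lam) * √P.lam := by
      rw [Real.sqrt_mul hr0.le, Real.sqrt_div zero_le_one, Real.sqrt_one]
      have e1 := Real.mul_self_sqrt hr0.le
      have e2 := Real.mul_self_sqrt hlam.le
      have e3 := Real.sqrt_pos.2 hr0
      field_simp
      nlinarith
    rw [h2]
    gcongr
  rw [postStd_eq hφ hlam, map_sum, inner_sum]
  simp only [map_smul, real_inner_smul_right]
  calc _ ≤ ∑ i ∈ Finset.range n, |c (s + i) * inner ℝ (φ a) (W (φ (x (s + i))))| :=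
        Finset.abs_sum_le_sum_abs _ _
    _ ≤ ∑ i ∈ Finset.range n, |c (s + i)| * (√(inner ℝ (φ a) (W (φ a))) * √(1 / r)) :=
        Finset.sum_le_sum hterm
    _ = (∑ i ∈ Finset.range n, |c (s + i)|) * (√(inner ℝ (φ a) (W (φ a))) * √(1 / r)) := by
        rw [Finset.sum_mul]
    _ ≤ C * (√(inner ℝ (φ a) (W (φ a))) * (√(n : ℝ) / (r * P.lam) * √P.lam)) := by gcongr
    _ = _ := by ring

end Run

/-! ### Elimination, per-epoch regret and summation over epochs. -/

section Elimination

variable {X : Type u} {H : Type v} [NormedAddCommGroup H] [InnerProductSpace ℝ H]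
  {φ : X → H} {P : Params X} {z : ℕ → ℕ → X} {x : ℕ → X} {g : X → ℝ} {e c : ℕ → ℝ}

lemma abs_robustMean_sub_le_width (hφ : ∀ a b, inner ℝ (φ a) (φ b) = P.k a b) (hlam : 0 < P.lam)
    (hpsi : 0 < P.psi) (hpl : P.psi * P.lam ≤ 1)
    (hrun : IsRun P z x fun t => g (x t) + e t + c t)
    (hc : ∑ t ∈ Finset.range P.T, |c t| ≤ P.C) {h : ℕ} (hT : epochStart P z (h + 1) ≤ P.T)
    (hconf : ∀ a, |postMean P.k P.lam (segment x (epochStart P z h) (epochLen P z h))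
        (segment (fun t => g (x t) + e t) (epochStart P z h) (epochLen P z h)) a - g a| ≤
      P.beta h * postStd P.k P.lam (segment x (epochStart P z h) (epochLen P z h)) a) (a : X) :
    |robustMean P.k P.lam (segment x (epochStart P z h) (epochLen P z h))
        (segment (fun t => g (x t) + e t + c t) (epochStart P z h) (epochLen P z h)) a - g a| ≤
      width P z x h a := by
  have h1 := hconf a
  have h2 := abs_corruption_le hφ hlam hpsi hpl hrun hT hc a
  rw [robustMean_eq_postMean hφ hlam, postMean_eq hφ hlam]
  rw [postMean_eq hφ hlam] at h1
  set s := epochStart P z h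
  set n := epochLen P z h
  have hsum : ∑ i : Fin n, segment (fun t => g (x t) + e t + c t) s n i • φ (x (s + i)) =
      ∑ i : Fin n, segment (fun t => g (x t) + e t) s n i • φ (x (s + i)) +
        ∑ i ∈ Finset.range n, c (s + i) • φ (x (s + i)) := by
    rw [Finset.sum_range, ← Finset.sum_add_distrib]
    refine Finset.sum_congr rfl fun i _ => ?_
    rw [← add_smul]
    rfl
  rw [hsum, map_add, inner_add_right, width, add_mul, add_sub_right_comm]
  exact (abs_add_le _ _).trans (add_le_add h1 h2)

/-- On valid intervals the upper bound at the maximizer is at least its value, hence at least every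
lower bound. -/
lemma maximizer_mem_activeSet {obs : ℕ → ℝ} {xs : X} (hxs : ∀ a, g a ≤ g xs)
    (herr : ∀ h, epochStart P z (h + 1) ≤ P.T → ∀ a,
      |robustMean P.k P.lam (segment x (epochStart P z h) (epochLen P z h))
        (segment obs (epochStart P z h) (epochLen P z h)) a - g a| ≤ width P z x h a)
    {h : ℕ} (hT : epochStart P z h ≤ P.T) : xs ∈ activeSet P z x obs h := by
  induction h with
  | zero => simp [activeSet]
  | succ h ih =>
    rw [activeSet]
    refine ⟨ih ((epochStart_mono z h.le_succ).trans hT), fun b _ => ?_⟩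
    have h1 := abs_le.1 (herr h hT b)
    have h2 := abs_le.1 (herr h hT xs)
    have h3 := hxs b
    linarith [h1.2, h2.1]

lemma gap_le_of_mem_activeSet {obs : ℕ → ℝ} {xs : X} {h : ℕ}
    (herr : ∀ a, |robustMean P.k P.lam (segment x (epochStart P z h) (epochLen P z h))
        (segment obs (epochStart P z h) (epochLen P z h)) a - g a| ≤ width P z x h a)
    (hxs : xs ∈ activeSet P z x obs h) {a : X} (ha : a ∈ activeSet P z x obs (h + 1)) :
    g xs - g a ≤ 2 * width P z x h xs + 2 * width P z x h a := by
  rw [activeSet] at ha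
  have h1 := ha.2 xs hxs
  have h2 := abs_le.1 (herr a)
  have h3 := abs_le.1 (herr xs)
  linarith [h2.2, h3.1]

/-- More data shrink the form, so the played data inherit the variance bound of the selection loop.
-/
lemma postStd_le_of_complete [Nonempty X] {obs : ℕ → ℝ}
    (hφ : ∀ a b, inner ℝ (φ a) (φ b) = P.k a b) (hk : ∀ a b, P.k a b ≤ 1) (hlam : 1 ≤ P.lam)
    (heta : 1 < P.eta) (hrun : IsRun P z x obs) {h : ℕ} (hT : epochStart P z (h + 1) ≤ P.T)
    {a : X} (ha : a ∈ activeSet P z x obs h) :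
    postStd P.k P.lam (segment x (epochStart P z h) (epochLen P z h)) a ≤
      2 * √(P.eta * P.lam) * √(maxInfoGain P.k P.lam P.T) / √(nominal h : ℝ) := by
  have hl : 0 < P.lam := by linarith
  have hnom : (0 : ℝ) < nominal h := by exact_mod_cast nominal_pos h
  have hsched := nominal_le_scheduledLen (P := P) h (z h)
  have hstart : epochStart P z (h + 1) = epochStart P z h + scheduledLen P h (z h) := rfl
  have hpos := nominal_pos h
  have h1 := mul_covOp_le_of_isSelection hφ hk hlam heta (hrun.select h (by omega)) ha
  have h2 : inner ℝ (φ a) (covOp P.lam (fun i => φ (x (epochStart P z h + i)))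
      (epochLen P z h) (φ a)) ≤ inner ℝ (φ a) (covOp P.lam (fun i => φ (z h i)) (nominal h) (φ a)) :=
    covOp_le_covOp hl (fun u => sum_selection_le hrun hT (F := fun b => inner ℝ (φ b) u ^ 2)
      fun b => sq_nonneg _) _
  have h3 : maxInfoGain P.k P.lam (nominal h) ≤ maxInfoGain P.k P.lam P.T :=
    maxInfoGain_monotone hφ hk hlam (by omega)
  have hG := maxInfoGain_nonneg hφ hk hlam P.T
  have h4 : inner ℝ (φ a) (covOp P.lam (fun i => φ (x (epochStart P z h + i)))
      (epochLen P z h) (φ a)) ≤ 2 ^ 2 * P.eta * maxInfoGain P.k P.lam P.T / nominal h := by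
    rw [le_div_iff₀ hnom]
    calc _ ≤ inner ℝ (φ a) (covOp P.lam (fun i => φ (z h i)) (nominal h) (φ a)) * nominal h := by
          gcongr
      _ ≤ 4 * P.eta * maxInfoGain P.k P.lam (nominal h) := by rw [mul_comm]; exact h1
      _ ≤ 4 * P.eta * maxInfoGain P.k P.lam P.T := by gcongr
      _ = _ := by ring
  rw [postStd_eq hφ hl]
  calc _ ≤ √P.lam * √(2 ^ 2 * P.eta * maxInfoGain P.k P.lam P.T / nominal h) := by gcongr
    _ = _ := by
      rw [Real.sqrt_div (by positivity), Real.sqrt_mul (by positivity),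
        Real.sqrt_mul (by positivity), Real.sqrt_sq (by norm_num), Real.sqrt_mul (by positivity)]
      ring

/-- The choice of `psi` makes `psi` times the number of chosen points at most `psi + 1 ≤ 2`, so the
padding costs only a constant factor. -/
lemma epochLen_le_of_reached [Nonempty X] {obs : ℕ → ℝ}
    (hφ : ∀ a b, inner ℝ (φ a) (φ b) = P.k a b) (hk : ∀ a b, P.k a b ≤ 1) (hlam : 1 ≤ P.lam)
    (heta : 1 < P.eta) (hpsi : P.psi = Real.log P.eta / (2 * maxInfoGain P.k P.lam P.T))
    (hG : 0 < maxInfoGain P.k P.lam P.T) (hpl : P.psi * P.lam ≤ 1)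
    (hrun : IsRun P z x obs) {h : ℕ} (hT : epochStart P z h < P.T) :
    (epochLen P z h : ℝ) ≤ 4 * nominal h := by
  have hlog : 0 < Real.log P.eta := Real.log_pos heta
  have hpsi0 : 0 < P.psi := by rw [hpsi]; positivity
  have hpsi1 : P.psi ≤ 1 := le_trans (le_mul_of_one_le_right hpsi0.le hlam) hpl
  have h2 := two_pow_le_epochStart (P := P) z h
  have hnom : nominal h ≤ P.T + 1 := by rw [nominal]; omega
  have hcard := card_chosen_mul_log_le hφ hk hlam heta (hrun.select h hT) hnom
  have h3 : P.psi * (chosen h (z h)).card ≤ 2 := by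
    have h4 : P.psi * (chosen h (z h)).card ≤ P.psi + 1 := by
      have e : P.psi + 1 = (Real.log P.eta + 2 * maxInfoGain P.k P.lam P.T) /
          (2 * maxInfoGain P.k P.lam P.T) := by
        rw [hpsi]
        field_simp
      rw [e, hpsi, div_mul_eq_mul_div, mul_comm]
      gcongr
    linarith
  have h4 : epochLen P z h ≤ scheduledLen P h (z h) := min_le_left _ _
  calc (epochLen P z h : ℝ) ≤ scheduledLen P h (z h) := by exact_mod_cast h4
    _ ≤ nominal h * (2 + P.psi * (chosen h (z h)).card) := scheduledLen_le hpsi0.le h (z h)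
    _ ≤ nominal h * (2 + 2) := by gcongr
    _ = _ := by ring

/-- Instantaneous regret in an epoch, in terms of the length of the preceding one. -/
lemma gap_le_of_reached [Nonempty X]
    (hφ : ∀ a b, inner ℝ (φ a) (φ b) = P.k a b) (hk : ∀ a b, P.k a b ≤ 1) (hlam : 1 ≤ P.lam)
    (heta : 1 < P.eta) (hC : 0 ≤ P.C)
    (hpsi : P.psi = Real.log P.eta / (2 * maxInfoGain P.k P.lam P.T))
    (hG : 0 < maxInfoGain P.k P.lam P.T) (hpl : P.psi * P.lam ≤ 1)
    (hrun : IsRun P z x fun t => g (x t) + e t + c t)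
    (hc : ∑ t ∈ Finset.range P.T, |c t| ≤ P.C)
    (hconf : ∀ h a, |postMean P.k P.lam (segment x (epochStart P z h) (epochLen P z h))
        (segment (fun t => g (x t) + e t) (epochStart P z h) (epochLen P z h)) a - g a| ≤
      P.beta h * postStd P.k P.lam (segment x (epochStart P z h) (epochLen P z h)) a)
    {xs : X} (hxs : ∀ a, g a ≤ g xs) {b : ℝ} (hb : 0 ≤ b) {h : ℕ} (hβ : P.beta h ≤ b)
    (hT : epochStart P z (h + 1) < P.T) (i : Fin (epochLen P z (h + 1))) :
    g xs - g (segment x (epochStart P z (h + 1)) (epochLen P z (h + 1)) i) ≤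
      8 * √(P.eta * P.lam) * √(maxInfoGain P.k P.lam P.T) *
        (b + 4 * P.C * maxInfoGain P.k P.lam P.T / (Real.log P.eta * √(nominal h : ℝ))) /
          √(nominal h : ℝ) := by
  classical
  set G := maxInfoGain P.k P.lam P.T with hGdef
  have hl : 0 < P.lam := by linarith
  have hlog : 0 < Real.log P.eta := Real.log_pos heta
  have hpsi0 : 0 < P.psi := by rw [hpsi]; positivity
  have hnom : (0 : ℝ) < nominal h := by exact_mod_cast nominal_pos h
  have herr : ∀ h, epochStart P z (h + 1) ≤ P.T → ∀ a, _ := fun h hh =>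
    abs_robustMean_sub_le_width hφ hl hpsi0 hpl hrun hc hh (hconf h)
  have hTh : epochStart P z h < P.T := (epochStart_mono z h.le_succ).trans_lt hT
  have hxsmem := maximizer_mem_activeSet hxs herr hTh.le
  set a := segment x (epochStart P z (h + 1)) (epochLen P z (h + 1)) i with ha
  have hamem : a ∈ activeSet P z x (fun t => g (x t) + e t + c t) (h + 1) := by
    have h1 := hrun.play_mem (h + 1) i
    rw [← ha, chosen, Finset.mem_image] at h1
    obtain ⟨j, hj, hja⟩ := h1
    rw [← hja]
    exact (hrun.select (h + 1) hT).mem j (Finset.mem_range.1 hj)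
  have hgap := gap_le_of_mem_activeSet (herr h hT.le) hxsmem hamem
  -- With epoch length at most `4 * nominal h`, the corruption coefficient is at most `2C / (psi
  -- √(nominal h))`, and `1 / psi = 2γ / log eta`.
  have hcoef : P.beta h + P.C * √(epochLen P z h : ℝ) / (nominal h * P.psi * P.lam) ≤
      b + 4 * P.C * G / (Real.log P.eta * √(nominal h : ℝ)) := by
    refine add_le_add hβ ?_
    have h1 : √(epochLen P z h : ℝ) ≤ 2 * √(nominal h : ℝ) := by
      have h2 := Real.sqrt_le_sqrt (epochLen_le_of_reached hφ hk hlam heta hpsi hG hpl hrun hTh)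
      rwa [show (4 : ℝ) = 2 ^ 2 by norm_num, Real.sqrt_mul (by norm_num),
        Real.sqrt_sq (by norm_num)] at h2
    calc P.C * √(epochLen P z h : ℝ) / (nominal h * P.psi * P.lam)
        ≤ P.C * (2 * √(nominal h : ℝ)) / (nominal h * P.psi * 1) := by gcongr
      _ = 4 * P.C * G / (Real.log P.eta * √(nominal h : ℝ)) := by
          have e1 := Real.mul_self_sqrt hnom.le
          have e2 := Real.sqrt_pos.2 hnom
          rw [hpsi]
          field_simp
          nlinarith
  have hw : ∀ a ∈ activeSet P z x (fun t => g (x t) + e t + c t) h, width P z x h a ≤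
      (b + 4 * P.C * G / (Real.log P.eta * √(nominal h : ℝ))) *
        (2 * √(P.eta * P.lam) * √G / √(nominal h : ℝ)) := by
    intro a ha
    rw [width]
    exact mul_le_mul hcoef (postStd_le_of_complete hφ hk hlam heta hrun hT.le ha)
      (Real.sqrt_nonneg _) (by positivity)
  have h1 := hw xs hxsmem
  have h2 := hw a (by rw [activeSet] at hamem; exact hamem.1)
  calc _ ≤ _ := hgap
    _ ≤ 4 * ((b + 4 * P.C * G / (Real.log P.eta * √(nominal h : ℝ))) *
        (2 * √(P.eta * P.lam) * √G / √(nominal h : ℝ))) := by linarith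
    _ = _ := by ring

lemma sum_range_epochStart_succ (r : ℕ → ℝ) (h : ℕ) :
    ∑ t ∈ Finset.range (min (epochStart P z (h + 1)) P.T), r t =
      ∑ t ∈ Finset.range (min (epochStart P z h) P.T), r t +
        ∑ i ∈ Finset.range (epochLen P z h), r (epochStart P z h + i) := by
  have hstart : epochStart P z (h + 1) = epochStart P z h + scheduledLen P h (z h) := rfl
  have hlen : epochLen P z h = min (scheduledLen P h (z h)) (P.T - epochStart P z h) := rfl
  by_cases hT : epochStart P z h < P.T
  · have e1 : min (epochStart P z (h + 1)) P.T = epochStart P z h + epochLen P z h := by omega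
    have e2 : min (epochStart P z h) P.T = epochStart P z h := by omega
    rw [e1, e2, Finset.sum_range_add]
  · have e1 : min (epochStart P z (h + 1)) P.T = min (epochStart P z h) P.T := by omega
    have e2 : epochLen P z h = 0 := by omega
    rw [e1, e2]
    simp

/-- Since epoch starts grow geometrically, epochs `0, …, Nat.log 2 T` already cover all `T` rounds;
epoch `0` is separate because no elimination precedes it. -/
lemma sum_le_of_epoch_bounds {r : ℕ → ℝ} {D₀ D : ℝ} (hD : 0 ≤ D)
    (h0 : ∑ i ∈ Finset.range (epochLen P z 0), r (epochStart P z 0 + i) ≤ D₀)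
    (h1 : ∀ h, epochStart P z (h + 1) < P.T →
      ∑ i ∈ Finset.range (epochLen P z (h + 1)), r (epochStart P z (h + 1) + i) ≤ D) :
    ∑ t ∈ Finset.range P.T, r t ≤ D₀ + Nat.log 2 P.T * D := by
  have key : ∀ h : ℕ, ∑ t ∈ Finset.range (min (epochStart P z (h + 1)) P.T), r t ≤ D₀ + h * D := by
    intro h
    induction h with
    | zero =>
      rw [sum_range_epochStart_succ]
      simpa [epochStart] using h0
    | succ h ih =>
      rw [sum_range_epochStart_succ]
      have : ∑ i ∈ Finset.range (epochLen P z (h + 1)), r (epochStart P z (h + 1) + i) ≤ D := by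
        by_cases hT : epochStart P z (h + 1) < P.T
        · exact h1 h hT
        · have e2 : epochLen P z (h + 1) = 0 := by rw [epochLen]; omega
          rw [e2]
          simpa using hD
      push_cast
      linarith
  have h2 := two_pow_le_epochStart (P := P) z (Nat.log 2 P.T + 1)
  have h3 := Nat.lt_pow_succ_log_self (b := 2) (by norm_num) P.T
  rw [pow_succ] at h2
  have h4 := key (Nat.log 2 P.T)
  have h5 : P.T ≤ epochStart P z (Nat.log 2 P.T + 1) := by
    rw [Nat.succ_eq_add_one] at h3
    omega
  rwa [min_eq_right h5] at h4

lemma natCast_le_two_mul_log {n T : ℕ} (h : 2 ^ n ≤ T) : (n : ℝ) ≤ 2 * Real.log T := by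
  have h1 : Real.log ((2 : ℝ) ^ n) ≤ Real.log T :=
    Real.log_le_log (by positivity) (by exact_mod_cast h)
  rw [Real.log_pow] at h1
  have h2 := Real.log_two_gt_d9
  have h3 : (0 : ℝ) ≤ n := Nat.cast_nonneg n
  nlinarith

/-- Epoch `0` has at most `4 * 2` rounds, each with gap at most `2B`. -/
lemma first_epoch_gap_le [Nonempty X] {obs : ℕ → ℝ}
    (hφ : ∀ a b, inner ℝ (φ a) (φ b) = P.k a b) (hk : ∀ a b, P.k a b ≤ 1) (hlam : 1 ≤ P.lam)
    (heta : 1 < P.eta) (hT1 : 1 ≤ P.T)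
    (hpsi : P.psi = Real.log P.eta / (2 * maxInfoGain P.k P.lam P.T))
    (hG : 0 < maxInfoGain P.k P.lam P.T) (hpl : P.psi * P.lam ≤ 1)
    (hrun : IsRun P z x obs) (xs : X) {B : ℝ} (hB : ∀ a, |g a| ≤ B) :
    ∑ i ∈ Finset.range (epochLen P z 0), (g xs - g (x (epochStart P z 0 + i))) ≤ 16 * B := by
  have hB0 : 0 ≤ B := (abs_nonneg _).trans (hB xs)
  have h1 := epochLen_le_of_reached hφ hk hlam heta hpsi hG hpl hrun (h := 0)
    (by rw [epochStart]; omega)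
  have h2 : ∑ i ∈ Finset.range (epochLen P z 0), (g xs - g (x (epochStart P z 0 + i))) ≤
      (epochLen P z 0) • (2 * B) := by
    refine (Finset.sum_le_card_nsmul _ _ (2 * B) fun i _ => ?_).trans_eq
      (by rw [Finset.card_range])
    have h3 := abs_le.1 (hB xs)
    have h4 := abs_le.1 (hB (x (epochStart P z 0 + i)))
    linarith [h3.2, h4.1]
  rw [nsmul_eq_mul] at h2
  have e : ((nominal 0 : ℕ) : ℝ) = 2 := by simp [nominal]
  rw [e] at h1
  have h3 := mul_le_mul_of_nonneg_right h1 hB0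
  linarith

/-- The epoch has at most `8 * nominal h` rounds, each with gap of order `1 / √(nominal h)`. In the
corruption part the gap is of order `1 / nominal h`, so the epoch index cancels. -/
lemma epoch_gap_le [Nonempty X]
    (hφ : ∀ a b, inner ℝ (φ a) (φ b) = P.k a b) (hk : ∀ a b, P.k a b ≤ 1) (hlam : 1 ≤ P.lam)
    (heta : 1 < P.eta) (hC : 0 ≤ P.C)
    (hpsi : P.psi = Real.log P.eta / (2 * maxInfoGain P.k P.lam P.T))
    (hG : 0 < maxInfoGain P.k P.lam P.T) (hpl : P.psi * P.lam ≤ 1)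
    (hrun : IsRun P z x fun t => g (x t) + e t + c t)
    (hc : ∑ t ∈ Finset.range P.T, |c t| ≤ P.C)
    (hconf : ∀ h a, |postMean P.k P.lam (segment x (epochStart P z h) (epochLen P z h))
        (segment (fun t => g (x t) + e t) (epochStart P z h) (epochLen P z h)) a - g a| ≤
      P.beta h * postStd P.k P.lam (segment x (epochStart P z h) (epochLen P z h)) a)
    {xs : X} (hxs : ∀ a, g a ≤ g xs) {b : ℝ} (hb : 0 ≤ b)
    (hβ : ∀ h, 2 ^ (h + 1) ≤ P.T → P.beta h ≤ b) {h : ℕ} (hT : epochStart P z (h + 1) < P.T) :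
    ∑ i ∈ Finset.range (epochLen P z (h + 1)), (g xs - g (x (epochStart P z (h + 1) + i))) ≤
      64 * √(P.eta * P.lam) * √(maxInfoGain P.k P.lam P.T) *
        (b * √(P.T : ℝ) + 4 * P.C * maxInfoGain P.k P.lam P.T / Real.log P.eta) := by
  have hlog : 0 < Real.log P.eta := Real.log_pos heta
  have hnom : (0 : ℝ) < nominal h := by exact_mod_cast nominal_pos h
  have hnT : nominal h ≤ P.T := by
    have := nominal_le_scheduledLen (P := P) h (z h)
    rw [epochStart] at hT
    omega
  have hgap := gap_le_of_reached hφ hk hlam heta hC hpsi hG hpl hrun hc hconf hxs hb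
    (hβ h hnT) hT
  have hlen := epochLen_le_of_reached hφ hk hlam heta hpsi hG hpl hrun hT
  have e : ((nominal (h + 1) : ℕ) : ℝ) = 2 * nominal h := by
    rw [nominal, nominal, pow_succ]
    push_cast
    ring
  rw [e] at hlen
  clear hconf hrun hβ
  generalize maxInfoGain P.k P.lam P.T = G at hG hgap ⊢
  set M := 8 * √(P.eta * P.lam) * √G *
      (b + 4 * P.C * G / (Real.log P.eta * √(nominal h : ℝ))) / √(nominal h : ℝ) with hM
  have hM0 : 0 ≤ M := by positivity
  have h2 : ∑ i ∈ Finset.range (epochLen P z (h + 1)),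
      (g xs - g (x (epochStart P z (h + 1) + i))) ≤ (epochLen P z (h + 1)) • M := by
    refine (Finset.sum_le_card_nsmul _ _ M fun i hi => ?_).trans_eq (by rw [Finset.card_range])
    exact hgap ⟨i, Finset.mem_range.1 hi⟩
  rw [nsmul_eq_mul] at h2
  have hsq : √(nominal h : ℝ) ≤ √(P.T : ℝ) := Real.sqrt_le_sqrt (by exact_mod_cast hnT)
  calc _ ≤ _ := h2
    _ ≤ 4 * (2 * nominal h) * M := by gcongr
    _ = 64 * √(P.eta * P.lam) * √G *
        (b * √(nominal h : ℝ) + 4 * P.C * G / Real.log P.eta) := by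
        have e1 := Real.mul_self_sqrt hnom.le
        have e2 := Real.sqrt_pos.2 hnom
        rw [hM]
        generalize √(nominal h : ℝ) = q at e1 e2 ⊢
        rw [← e1]
        field_simp
        ring
    _ ≤ _ := by gcongr

/-- Cumulative regret on the event that the confidence bounds hold, when `psi * lam ≤ 1`. -/
lemma sum_gap_le [Nonempty X]
    (hφ : ∀ a b, inner ℝ (φ a) (φ b) = P.k a b) (hk : ∀ a b, P.k a b ≤ 1) (hlam : 1 ≤ P.lam)
    (heta : 1 < P.eta) (hC : 0 ≤ P.C) (hT1 : 1 ≤ P.T)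
    (hpsi : P.psi = Real.log P.eta / (2 * maxInfoGain P.k P.lam P.T))
    (hG : 0 < maxInfoGain P.k P.lam P.T) (hpl : P.psi * P.lam ≤ 1)
    (hrun : IsRun P z x fun t => g (x t) + e t + c t)
    (hc : ∑ t ∈ Finset.range P.T, |c t| ≤ P.C)
    (hconf : ∀ h a, |postMean P.k P.lam (segment x (epochStart P z h) (epochLen P z h))
        (segment (fun t => g (x t) + e t) (epochStart P z h) (epochLen P z h)) a - g a| ≤
      P.beta h * postStd P.k P.lam (segment x (epochStart P z h) (epochLen P z h)) a)
    {xs : X} (hxs : ∀ a, g a ≤ g xs) {B b : ℝ} (hB : ∀ a, |g a| ≤ B) (hb : 0 ≤ b)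
    (hβ : ∀ h, 2 ^ (h + 1) ≤ P.T → P.beta h ≤ b) :
    ∑ t ∈ Finset.range P.T, (g xs - g (x t)) ≤ 16 * B + 2 * Real.log P.T *
      (64 * √(P.eta * P.lam) * √(maxInfoGain P.k P.lam P.T) *
        (b * √(P.T : ℝ) + 4 * P.C * maxInfoGain P.k P.lam P.T / Real.log P.eta)) := by
  have hlog : 0 < Real.log P.eta := Real.log_pos heta
  refine (sum_le_of_epoch_bounds (r := fun t => g xs - g (x t)) (by positivity)
    (first_epoch_gap_le hφ hk hlam heta hT1 hpsi hG hpl hrun xs hB)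
    fun h hT => epoch_gap_le hφ hk hlam heta hC hpsi hG hpl hrun hc hconf hxs hb hβ hT).trans ?_
  have h2 := natCast_le_two_mul_log (Nat.pow_log_le_self 2 (by omega : P.T ≠ 0))
  gcongr

end Elimination

/-! ### Absorbing constants and logarithms into the final bound. -/

section Constants

/-- Uses `2 log (h + 1) ≤ 2 (h + 1) ≤ 4 log T`; the last `1` covers `log (π² / 6)`. The restriction
on `h` is met by every epoch completed within the horizon. -/
lemma log_one_div_deltaSeq_le {δ : ℝ} (hδ : 0 < δ) {h T : ℕ} (hT : 2 ^ (h + 1) ≤ T) :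
    Real.log (1 / deltaSeq δ h) ≤ Real.log (1 / δ) + 4 * Real.log T + 1 := by
  have hpi := Real.pi_pos
  have e : 1 / deltaSeq δ h = (1 / δ) * (((h : ℝ) + 1) ^ 2 * (Real.pi ^ 2 / 6)) := by
    rw [deltaSeq]
    field_simp
  rw [e, Real.log_mul (by positivity) (by positivity), Real.log_mul (by positivity) (by positivity),
    Real.log_pow]
  have h1 : Real.log ((h : ℝ) + 1) ≤ h + 1 := Real.log_le_self (by positivity)
  have h2 := natCast_le_two_mul_log hT
  push_cast at h2 ⊢
  have h3 : Real.log (Real.pi ^ 2 / 6) ≤ 1 := by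
    have := Real.log_le_sub_one_of_pos (by positivity : 0 < Real.pi ^ 2 / 6)
    have := Real.pi_lt_d2
    nlinarith
  linarith

/-- The floor `g₀` on the information gain lets additive constants be absorbed: `B ≤ B √(G / g₀)`
and `4 ≤ (4 / g₀) G`. -/
lemma betaSeq_le {X : Type u} {k : X → X → ℝ} {lam B δ g₀ : ℝ} {σ : ℝ≥0} {T h : ℕ} (hB : 0 ≤ B)
    (hg₀ : 0 < g₀) (hG : g₀ ≤ maxInfoGain k lam T) (hδ : 0 < δ) (hδ1 : δ < 1)
    (hT : 2 ^ (h + 1) ≤ T) :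
    betaSeq k lam B σ δ (fun _ => T) h ≤ (B / √g₀ + σ * √(2 * (1 + 4 / g₀))) *
      √(maxInfoGain k lam T) * √(1 + Real.log (1 / δ)) * (1 + Real.log T) := by
  rw [betaSeq]
  set G := maxInfoGain k lam T
  set L := Real.log (1 / δ)
  have hL : 0 ≤ L := Real.log_nonneg (by rw [le_div_iff₀ hδ]; linarith)
  have hT1 : 1 ≤ T := (Nat.one_le_two_pow).trans hT
  have hlT : 0 ≤ Real.log T := Real.log_natCast_nonneg T
  have hG0 : 0 < G := hg₀.trans_le hG
  have hδh := log_one_div_deltaSeq_le hδ hT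
  have h1L : 1 ≤ √(1 + L) := Real.one_le_sqrt.2 (by linarith)
  have hin : 2 * (G + 1 + Real.log (1 / deltaSeq δ h)) ≤
      (2 * (1 + 4 / g₀)) * G * (1 + L) * (1 + Real.log T) ^ 2 := by
    have h2 : G + 4 ≤ (1 + 4 / g₀) * G := by
      have : 4 ≤ 4 / g₀ * G := by
        rw [div_mul_eq_mul_div, le_div_iff₀ hg₀]
        linarith
      linarith
    have h3 : G + 1 + Real.log (1 / deltaSeq δ h) ≤ (G + 4) * ((1 + L) * (1 + Real.log T)) := by
      have h4 := mul_nonneg hL hlT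
      have h5 : 0 ≤ (G + 4) * (L * Real.log T) := by positivity
      have h6 : 0 ≤ G * (L + Real.log T) := by positivity
      nlinarith
    have h4 : (1 + L) * (1 + Real.log T) ≤ (1 + L) * (1 + Real.log T) ^ 2 := by
      gcongr
      exact le_self_pow₀ (by linarith) two_ne_zero
    calc _ ≤ 2 * ((G + 4) * ((1 + L) * (1 + Real.log T))) := by linarith
      _ ≤ 2 * (((1 + 4 / g₀) * G) * ((1 + L) * (1 + Real.log T) ^ 2)) := by gcongr
      _ = _ := by ring
  have hsq := Real.sqrt_le_sqrt hin
  have hroot : √((2 * (1 + 4 / g₀)) * G * (1 + L) * (1 + Real.log T) ^ 2) =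
      √(2 * (1 + 4 / g₀)) * √G * √(1 + L) * (1 + Real.log T) := by
    rw [Real.sqrt_mul (by positivity), Real.sqrt_mul (by positivity), Real.sqrt_mul (by positivity),
      Real.sqrt_sq (by positivity)]
  rw [hroot] at hsq
  have hBle : B ≤ B / √g₀ * √G * √(1 + L) * (1 + Real.log T) := by
    have h2 : B ≤ B / √g₀ * √G := by
      rw [div_mul_eq_mul_div, le_div_iff₀ (Real.sqrt_pos.2 hg₀)]
      gcongr
    calc B = B * 1 * 1 := by ring
      _ ≤ B / √g₀ * √G * √(1 + L) * (1 + Real.log T) := by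
        gcongr
        linarith
  calc _ ≤ B / √g₀ * √G * √(1 + L) * (1 + Real.log T) +
        σ * (√(2 * (1 + 4 / g₀)) * √G * √(1 + L) * (1 + Real.log T)) := by gcongr
    _ = _ := by ring

end Constants

/-- A lower bound for the maximum information gain when the kernel reaches `κ` on the diagonal. -/
def gainFloor (lam κ : ℝ) : ℝ := 1 / 2 * Real.log (1 + κ / lam)

/-- The constant of the regret bound. -/
def regretConst (B : ℝ) (σ : ℝ≥0) (lam eta κ : ℝ) : ℝ :=
  16 * |B| / gainFloor lam κ +
    128 * √(eta * lam) *
      (|B| / √(gainFloor lam κ) + σ * √(2 * (1 + 4 / gainFloor lam κ)) + 4 / Real.log eta) +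
    2 * |B| * (lam / κ * Real.exp (lam * Real.log eta)) / gainFloor lam κ + 1

lemma gainFloor_pos {lam κ : ℝ} (hlam : 0 < lam) (hκ : 0 < κ) : 0 < gainFloor lam κ := by
  rw [gainFloor]
  have : 0 < Real.log (1 + κ / lam) := Real.log_pos (by linarith [div_pos hκ hlam])
  positivity

lemma regretConst_pos (B : ℝ) (σ : ℝ≥0) {lam eta κ : ℝ} (hlam : 0 < lam) (heta : 1 < eta)
    (hκ : 0 < κ) : 0 < regretConst B σ lam eta κ := by
  have h1 := gainFloor_pos hlam hκ
  have h2 := Real.log_pos heta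
  rw [regretConst]
  positivity

lemma rpow_three_halves {G : ℝ} (hG : 0 < G) : G ^ (3 / 2 : ℝ) = G * √G := by
  rw [show (3 / 2 : ℝ) = 1 + 1 / 2 by norm_num, Real.rpow_add hG, Real.rpow_one,
    Real.sqrt_eq_rpow]

/-- The regret bound on a sample where the confidence bounds hold. -/
lemma sum_gap_le_regretConst {X : Type u} {H : Type v} [NormedAddCommGroup H]
    [InnerProductSpace ℝ H] {φ : X → H} {k : X → X → ℝ} {B lam eta κ C δ : ℝ} {σ : ℝ≥0} {T : ℕ}
    {z : ℕ → ℕ → X} {x : ℕ → X} {g : X → ℝ} {e c : ℕ → ℝ} {P : Params X}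
    (hP : P = ⟨k, lam, eta, Real.log eta / (2 * maxInfoGain k lam T), C,
      betaSeq k lam B σ δ (fun _ => T), T⟩)
    (hlam : 1 ≤ lam) (heta : 1 < eta) (hκ : 0 < κ) (hT : 1 ≤ T) (hC : 0 ≤ C) (hδ : 0 < δ)
    (hδ1 : δ < 1) (hφ : ∀ a b, inner ℝ (φ a) (φ b) = k a b) (hk : ∀ a b, k a b ≤ 1)
    {a₀ : X} (ha₀ : κ ≤ k a₀ a₀) (hB : ∀ a, |g a| ≤ B)
    (hrun : IsRun P z x fun t => g (x t) + e t + c t)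
    (hc : ∑ t ∈ Finset.range T, |c t| ≤ C)
    (hconf : ∀ h a, |postMean P.k P.lam (segment x (epochStart P z h) (epochLen P z h))
        (segment (fun t => g (x t) + e t) (epochStart P z h) (epochLen P z h)) a - g a| ≤
      P.beta h * postStd P.k P.lam (segment x (epochStart P z h) (epochLen P z h)) a)
    {xs : X} (hxs : ∀ a, g a ≤ g xs) :
    ∑ t ∈ Finset.range T, (g xs - g (x t)) ≤ regretConst B σ lam eta κ * (1 + Real.log T) ^ 2 *
      (√(1 + Real.log (1 / δ)) * (√T * maxInfoGain k lam T) +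
        C * maxInfoGain k lam T ^ (3 / 2 : ℝ)) := by
  have : Nonempty X := ⟨xs⟩
  have hl : 0 < lam := by linarith
  have hB0 : 0 ≤ B := (abs_nonneg _).trans (hB xs)
  have hg₀ := gainFloor_pos hl hκ
  have hlogη := Real.log_pos heta
  have hGT := log_one_add_le_maxInfoGain hφ hk hlam hκ.le ha₀ T
  have hT' : (1 : ℝ) ≤ T := by exact_mod_cast hT
  have hG : gainFloor lam κ ≤ maxInfoGain k lam T := by
    refine le_trans ?_ hGT
    rw [gainFloor]
    have := le_mul_of_one_le_left (div_pos hκ hl).le hT'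
    gcongr
  have hG0 : 0 < maxInfoGain k lam T := hg₀.trans_le hG
  have hlogT : 0 ≤ Real.log T := Real.log_natCast_nonneg T
  have hL : 0 ≤ Real.log (1 / δ) := Real.log_nonneg (by rw [le_div_iff₀ hδ]; linarith)
  rw [rpow_three_halves hG0]
  set E := √(1 + Real.log (1 / δ)) * (√T * maxInfoGain k lam T) +
    C * (maxInfoGain k lam T * √(maxInfoGain k lam T)) with hE
  have hEG : gainFloor lam κ ≤ E := by
    have h1 : 1 ≤ √(1 + Real.log (1 / δ)) := Real.one_le_sqrt.2 (by linarith)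
    have h2 : 1 ≤ √(T : ℝ) := Real.one_le_sqrt.2 hT'
    have h3 : 0 ≤ C * (maxInfoGain k lam T * √(maxInfoGain k lam T)) := by positivity
    calc gainFloor lam κ ≤ 1 * (1 * maxInfoGain k lam T) := by linarith
      _ ≤ √(1 + Real.log (1 / δ)) * (√T * maxInfoGain k lam T) := by gcongr
      _ ≤ E := by linarith
  have hE0 : 0 < E := hg₀.trans_le hEG
  have hQ : 1 ≤ (1 + Real.log T) ^ 2 := one_le_pow₀ (by linarith)
  -- The target expression is at least `gainFloor`, so any constant is absorbed at the price of
  -- dividing by it.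
  have hscale : ∀ A : ℝ, 0 ≤ A → A ≤ A / gainFloor lam κ * ((1 + Real.log T) ^ 2 * E) := by
    intro A hA
    have h1 : gainFloor lam κ ≤ (1 + Real.log T) ^ 2 * E :=
      hEG.trans (le_mul_of_one_le_left hE0.le hQ)
    calc A = A / gainFloor lam κ * gainFloor lam κ := by field_simp
      _ ≤ _ := by gcongr
  set c₁ := 16 * |B| / gainFloor lam κ with hc₁
  set c₄ := |B| / √(gainFloor lam κ) + σ * √(2 * (1 + 4 / gainFloor lam κ)) with hc₄
  set c₂ := 128 * √(eta * lam) * (c₄ + 4 / Real.log eta) with hc₂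
  set c₃ := 2 * |B| * (lam / κ * Real.exp (lam * Real.log eta)) / gainFloor lam κ with hc₃
  have hK : regretConst B σ lam eta κ = c₁ + c₂ + c₃ + 1 := rfl
  have hc₁0 : 0 ≤ c₁ := by positivity
  have hc₄0 : 0 ≤ c₄ := by positivity
  have hc₂0 : 0 ≤ c₂ := by positivity
  have hc₃0 : 0 ≤ c₃ := by positivity
  rw [hK, mul_assoc]
  -- The width controls the corruption only under `psi * lam ≤ 1`; the other case occurs only for
  -- `T` below a constant.
  by_cases hpl : P.psi * P.lam ≤ 1
  · have hb : ∀ h, 2 ^ (h + 1) ≤ P.T → P.beta h ≤ c₄ * √(maxInfoGain k lam T) *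
        √(1 + Real.log (1 / δ)) * (1 + Real.log T) := by
      intro h hh
      subst hP
      have := betaSeq_le (k := k) (lam := lam) (σ := σ) hB0 hg₀ hG hδ hδ1 hh
      rwa [hc₄, abs_of_nonneg hB0]
    have hmain : ∑ t ∈ Finset.range T, (g xs - g (x t)) ≤ 16 * B + 2 * Real.log T *
        (64 * √(eta * lam) * √(maxInfoGain k lam T) *
          (c₄ * √(maxInfoGain k lam T) * √(1 + Real.log (1 / δ)) * (1 + Real.log T) * √(T : ℝ) +
            4 * C * maxInfoGain k lam T / Real.log eta)) := by
      subst hP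
      exact sum_gap_le hφ hk hlam heta hC hT rfl hG0 hpl hrun hc hconf hxs hB (by positivity) hb
    have h1 : 16 * B ≤ c₁ * ((1 + Real.log T) ^ 2 * E) := by
      have := hscale (16 * |B|) (by positivity)
      rw [← hc₁] at this
      linarith [le_abs_self B]
    have h2 : √(maxInfoGain k lam T) *
          (c₄ * √(maxInfoGain k lam T) * √(1 + Real.log (1 / δ)) * (1 + Real.log T) * √(T : ℝ) +
            4 * C * maxInfoGain k lam T / Real.log eta) ≤
        (c₄ + 4 / Real.log eta) * ((1 + Real.log T) * E) := by
      have hs := Real.mul_self_sqrt hG0.le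
      have e1 : √(maxInfoGain k lam T) *
          (c₄ * √(maxInfoGain k lam T) * √(1 + Real.log (1 / δ)) * (1 + Real.log T) * √(T : ℝ) +
            4 * C * maxInfoGain k lam T / Real.log eta) =
          c₄ * ((1 + Real.log T) * (√(1 + Real.log (1 / δ)) *
            (√T * (√(maxInfoGain k lam T) * √(maxInfoGain k lam T))))) +
          4 / Real.log eta * (1 * (C * (maxInfoGain k lam T * √(maxInfoGain k lam T)))) := by
        ring
      rw [e1, hs, add_mul c₄]
      have h3 : 0 ≤ C * (maxInfoGain k lam T * √(maxInfoGain k lam T)) := by positivity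
      have h4 : 0 ≤ √(1 + Real.log (1 / δ)) * (√T * maxInfoGain k lam T) := by positivity
      refine add_le_add (mul_le_mul_of_nonneg_left ?_ hc₄0)
        (mul_le_mul_of_nonneg_left ?_ (by positivity : 0 ≤ 4 / Real.log eta))
      · exact mul_le_mul_of_nonneg_left (by linarith) (by linarith)
      · exact mul_le_mul (by linarith) (by linarith) h3 (by linarith)
    have h3 : 2 * Real.log T * (64 * √(eta * lam) * √(maxInfoGain k lam T) *
          (c₄ * √(maxInfoGain k lam T) * √(1 + Real.log (1 / δ)) * (1 + Real.log T) * √(T : ℝ) +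
            4 * C * maxInfoGain k lam T / Real.log eta)) ≤
        c₂ * ((1 + Real.log T) ^ 2 * E) := by
      rw [mul_assoc (64 * √(eta * lam))]
      calc _ ≤ 2 * (1 + Real.log T) * (64 * √(eta * lam) *
            ((c₄ + 4 / Real.log eta) * ((1 + Real.log T) * E))) := by
            gcongr
            linarith
        _ = _ := by rw [hc₂]; ring
    have h4 : 0 ≤ (c₃ + 1) * ((1 + Real.log T) ^ 2 * E) := by positivity
    linarith
  · have hTle : (T : ℝ) ≤ lam / κ * Real.exp (lam * Real.log eta) := by
      rw [hP, not_le] at hpl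
      simp only at hpl
      rw [div_mul_eq_mul_div, lt_div_iff₀ (by positivity), one_mul] at hpl
      -- Failure of the condition says `2γ < lam * log eta`, and `2γ` dominates the left-hand
      -- logarithm.
      have h1 : Real.log (1 + T * (κ / lam)) ≤ lam * Real.log eta := by linarith
      rw [Real.log_le_iff_le_exp (by positivity)] at h1
      have h2 : T * (κ / lam) ≤ Real.exp (lam * Real.log eta) := by linarith
      calc (T : ℝ) = lam / κ * (T * (κ / lam)) := by field_simp
        _ ≤ _ := by gcongr
    have h1 : ∑ t ∈ Finset.range T, (g xs - g (x t)) ≤ T * (2 * B) := by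
      rw [← nsmul_eq_mul]
      refine (Finset.sum_le_card_nsmul _ _ (2 * B) fun t _ => ?_).trans_eq
        (by rw [Finset.card_range])
      have h3 := abs_le.1 (hB xs)
      have h4 := abs_le.1 (hB (x t))
      linarith [h3.2, h4.1]
    have h2 := hscale (2 * |B| * (lam / κ * Real.exp (lam * Real.log eta))) (by positivity)
    rw [← hc₃] at h2
    have h3 : (T : ℝ) * (2 * B) ≤ 2 * |B| * (lam / κ * Real.exp (lam * Real.log eta)) := by
      rw [abs_of_nonneg hB0, mul_comm]
      gcongr
    have h4 : 0 ≤ (c₁ + c₂ + 1) * ((1 + Real.log T) ^ 2 * E) := by positivity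
    linarith

end RGPPE
end

/-! ### Assembly of the confidence statement and the regret bound. -/

open RGPPE
theorem corollary2 (B : ℝ) (σ : ℝ≥0) (lam eta κ : ℝ)
    (hlam : 1 ≤ lam) (heta : 1 < eta) (hκ : 0 < κ) :
    ∃ K : ℝ, 0 < K ∧
      ∀ (X : Type u) [MetricSpace X] [CompactSpace X] [MeasurableSpace X] [BorelSpace X]
        (k : X → X → ℝ) (_ : Continuous fun p : X × X => k p.1 p.2) (_ : ∀ a b, k a b ≤ 1)
        (H : Type v) [NormedAddCommGroup H] [InnerProductSpace ℝ H] [CompleteSpace H]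
        [RKHS ℝ H X ℝ] (_ : ∀ a b, RKHS.kernel H a b 1 = k a b)
        (f : H) (_ : ‖f‖ ≤ B)
        (T : ℕ) (_ : 1 ≤ T) (C : ℝ) (_ : 0 ≤ C) (δ : ℝ) (_ : 0 < δ) (_ : δ < 1)
        (Ω : Type w) [mΩ : MeasurableSpace Ω] (μ : Measure Ω) [IsProbabilityMeasure μ]
        (ℱ : Filtration ℕ mΩ) (ε c : ℕ → Ω → ℝ) (x : ℕ → Ω → X) (z : ℕ → ℕ → Ω → X),
        -- the confidence parameters are valid
        (∀ (psi : ℝ) (ubar : ℕ → ℕ) (P : Params X), 0 < psi →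
          P = ⟨k, lam, eta, psi, C, betaSeq k lam B σ δ ubar, T⟩ →
          IsExecution P f σ μ ℱ ε c x z →
          (∀ᵐ ω ∂μ, ∀ h, epochLen P (fun j n => z j n ω) h ≤ ubar h) →
          (Monotone ubar → Monotone P.beta) ∧
            HoldsWithProb μ δ (ConfidenceBoundsAt P f ε x z)) ∧
        -- the regret bound, for `ubar h = T`
        ((∃ a, κ ≤ k a a) →
          IsExecution ⟨k, lam, eta, Real.log eta / (2 * maxInfoGain k lam T), C,
            betaSeq k lam B σ δ (fun _ => T), T⟩ f σ μ ℱ ε c x z →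
          HoldsWithProb μ δ fun ω =>
            regret f T (fun t => x t ω) ≤
              K * (1 + Real.log T) ^ 2 *
                (√(1 + Real.log (1 / δ)) * (√T * maxInfoGain k lam T) +
                  C * maxInfoGain k lam T ^ (3 / 2 : ℝ))) := by
  refine ⟨regretConst B σ lam eta κ, regretConst_pos B σ (by linarith) heta hκ, ?_⟩
  intro X _ _ _ _ k hkc hk H _ _ _ _ hker f hf T hT C hC δ hδ hδ1 Ω _ μ _ ℱ ε c x z
  have hφ := inner_feature (H := H) hker
  have hφc := continuous_of_continuous_inner hφ hkc
  have hg := apply_eq_inner_feature (X := X) f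
  refine ⟨?_, ?_⟩
  · intro psi ubar P hpsi hP hE hu
    have : Nonempty Ω := μ.nonempty_of_neZero
    have : Nonempty X := ⟨x 0 (Classical.arbitrary Ω)⟩
    refine ⟨fun hmono => ?_, ?_⟩
    · rw [hP]
      exact betaSeq_monotone hφ hk hlam hδ hmono
    · exact holdsWithProb_confidenceBounds hφ hk hφc hlam hg hf hδ (by rw [hP]) (by rw [hP])
        (by rw [hP]) hE hu
  · rintro ⟨a₀, ha₀⟩ hE
    have : Nonempty X := ⟨a₀⟩
    set P : Params X := ⟨k, lam, eta, Real.log eta / (2 * maxInfoGain k lam T), C,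
      betaSeq k lam B σ δ (fun _ => T), T⟩ with hP
    have hprob : HoldsWithProb μ δ (ConfidenceBoundsAt P f ε x z) :=
      holdsWithProb_confidenceBounds (ubar := fun _ => T) hφ hk hφc hlam hg hf hδ rfl rfl rfl hE
        -- The choice `ubar h = T` is always valid, since no epoch outlasts the horizon.
        (Filter.Eventually.of_forall fun ω h => (min_le_right _ _).trans (Nat.sub_le _ _))
    have hfc : Continuous f := by
      have : (f : X → ℝ) = fun a => inner ℝ (feature H a) f := funext hg
      rw [this]
      fun_prop
    obtain ⟨xs, -, hxs⟩ := isCompact_univ.exists_isMaxOn Set.univ_nonempty hfc.continuousOn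
    have hxs' : ∀ a, f a ≤ f xs := fun a => hxs (Set.mem_univ a)
    have hsup : ⨆ a, f a = f xs :=
      le_antisymm (ciSup_le hxs') (le_ciSup ⟨f xs, Set.forall_mem_range.2 hxs'⟩ xs)
    have hB : ∀ a, |f a| ≤ B := by
      intro a
      rw [hg]
      have h1 : ‖feature H a‖ ≤ 1 := by
        rw [← sq_le_one_iff₀ (norm_nonneg _), ← real_inner_self_eq_norm_sq, hφ]
        exact hk a a
      calc _ ≤ ‖feature H a‖ * ‖f‖ := abs_real_inner_le_norm _ _
        _ ≤ 1 * B := by gcongr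
        _ = B := one_mul B
    rw [HoldsWithProb] at hprob ⊢
    -- The run and the corruption budget hold only almost surely, so the inclusion of failure events
    -- is needed only up to a null set.
    refine le_trans (measure_mono_ae ?_) hprob
    filter_upwards [hE.run, hE.corr_budget] with ω hrun hbudget hbad hconf
    refine hbad ?_
    rw [regret, hsup]
    exact sum_gap_le_regretConst hP hlam heta hκ hT hC hδ hδ1 hφ hk ha₀ hB hrun hbudget
      hconf hxs'
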